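/- **Theorem 2.1.** Let $d\in\mathbb N$, $s\in(\tfrac12,1)$, $m\ge 1$. Write $B_r$ for the ball of radius $r$ centred at $0$ in $\mathbb R^d$, $B=B_1$, $\omega_s(y)=(1+|y|^{d+2s})^{-1}$, $a^+=\max\{a,0\}$, $a^-=\min\{a,0\}$, $\mathrm{osc}_E u=\sup_E u-\inf_E u$, and $$\mathscr H(u,E)=\sup_{x\in E}\int_{\mathbb R^d}\frac{|u(x+y)-u(x)|}{1+|y|^{d+2s}}\,dy .$$ Let $0<\lambda\le\Lambda$, $\kappa>0$, and consider the following data: a measurable kernel $K$, not necessarily symmetric, with $\lambda|y|^{-(d+2s)}\le K(y)\le\Lambda|y|^{-(d+2s)}$ for $y\neq0$; $\alpha\ge0$; $f\in C(\mathbb R^d)$; and $H\in C(\mathbb R^d\times\mathbb R^d)$ such that * (H1) for each $R>0$ there is $C_{H,R}>0$ with $|H(x,p+q)-H(y,p)|\le C_{H,R}\big[|x-y|(1+|p|^m)+|q|(|p|^{m-1}+|q|^{m-1})\big]$ for all $x,y\in B_R$ and $p,q\in\mathbb R^d$ with $|q|\le R$; * (H2) if $m\ge 2s+1$: $\frac1\kappa|p|^m-\kappa\le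 H(x,p)$ for all $x,p\in\mathbb R^d$. For $R>0$ let $u\in C(\mathbb R^d)\cap L^1(\omega_s)$ be a viscosity solution of $$\alpha u-Iu+H(x,\nabla u)-f(x)=0\ \text{ in } B_{R+2},\qquad Iu(x)=\int_{\mathbb R^d}\big(u(x+y)-u(x)-\chi_B(y)\,y\cdot\nabla u(x)\big)K(y)\,dy .$$ Here viscosity subsolution means: whenever $x_0\in B_{R+2}$, $\delta>0$, $\varphi\in C^2(\mathbb R^d)$ and $u-\varphi$ has at $x_0$ a maximum over $B_\delta(x_0)$, then $\alpha u(x_0)-I_\delta+H(x_0,\nabla\varphi(x_0))-f(x_0)\le0$, where $$I_\delta=\int_{B_\delta}\big(\varphi(x_0+y)-\varphi(x_0)-\chi_B(y)\,y\cdot\nabla\varphi(x_0)\big)K(y)\,dy+\int_{B_\delta^c}\big(u(x_0+y)-u(x_0)-\chi_B(y)\,y\cdot\nabla\varphi(x_0)\big)K(y)\,dy ;$$ supersolutions are defined with minima and $\ge$, and a solution is both. Then there is $C_R>0$ with $$|u(x)-u(y)|\le C_R|x-y|\quad\text{for all }x,y\in B_R .$$ The constant can be taken as follows. Put $\mathfrak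 Z_2=1+\mathrm{osc}_{B_{R+2}}u+\mathrm{osc}_{B_{R+2}}f+\mathscr H(u,B_{R+2})$ and, when $m\ge2s+1$, $\gamma_0=\frac{m-2s}{m-1}$, $A=1+\sup_{B_{R+2}}f^+-\alpha\inf_{B_{R+2}}u^-+\mathscr H(u,B_{R+2})$ and $\mathfrak Z_1(\rho)=\rho^{1-\gamma_0}\big(A^{1/m}+\mathrm{osc}_{B_{R+2}}u\big)$. There is $\bar\theta\in(0,1]$ depending only on $d,s,m$ such that for each $\theta_0\in(0,\bar\theta)$ there is $C>0$ depending only on $d,s,m,\lambda,\Lambda,\kappa,\theta_0$ (in particular not on $K,\alpha,H,f,R,u$; the dependence on $\kappa$ concerns only the case $m\ge 2s+1$) for which one can take $$C_R=C\,C_{H,R+2}^{\frac1{1-\theta_0}}\max\{\mathfrak Z_1(\max\{1,R\}),\mathfrak Z_2\}^{\frac{m-\theta_0}{1-\theta_0}}\quad\text{if } m\ge2s+1,$$ $$C_R=C\,\max\{1,C_{H,R+2}\}^{\frac1{2s+1-m-\theta_0}}\,\mathfrak Z_2^{\frac{2s-\theta_0}{2s+1-m-\theta_0}}\quad\text{if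 } m<2s+1 .$$ Moreover, if $m\ge2s+1$ and $C$ is allowed to depend also on $K,\alpha,f,H$ and on the function $R\mapsto C_{H,R}$ (but not on $R$ or $u$), then $\mathfrak Z_1(\max\{1,R\})$ may be replaced by $\mathfrak Z_1(R)$ for all $R>0$. -/

import Mathlib

open MeasureTheory

noncomputable section

namespace NonlocalHJ

/-- The space `ℝ^d` with its Euclidean norm. -/
abbrev E (d : ℕ) := EuclideanSpace ℝ (Fin d)

/-- `K` is a kernel of order `2s`:
`lam |y|^{-(d+2s)} ≤ K y ≤ Lam |y|^{-(d+2s)}` for `y ≠ 0`. No symmetry is required. -/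
def IsElliptic (d : ℕ) (s lam Lam : ℝ) (K : E d → ℝ) : Prop :=
  ∀ y : E d, y ≠ 0 →
    lam * ‖y‖ ^ (-((d : ℝ) + 2 * s)) ≤ K y ∧ K y ≤ Lam * ‖y‖ ^ (-((d : ℝ) + 2 * s))

/-- The nonlocal evaluation
`I[A](u, p, x) = ∫_A (u(x+y) - u(x) - χ_B(y) y·p) K(y) dy`, where `B` is the unit ball. -/
def nonlocalEval {d : ℕ} (K : E d → ℝ) (A : Set (E d)) (u : E d → ℝ) (p x : E d) : ℝ :=
  ∫ y in A,
    (u (x + y) - u x - (Metric.ball (0 : E d) 1).indicator (fun z => inner ℝ z p) y) * K y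

/-- Membership in the weighted space `L¹(ω_s)`, `ω_s(y) = (1 + |y|^{d+2s})⁻¹`. -/
def MemL1Weighted (d : ℕ) (s : ℝ) (u : E d → ℝ) : Prop :=
  LocallyIntegrable u volume ∧
    Integrable (fun y : E d => |u y| * (1 + ‖y‖ ^ ((d : ℝ) + 2 * s))⁻¹) volume

/-- Viscosity subsolution of `α u - I u + H(x, ∇u) - f = 0` in `Ω`: whenever `φ` is `C²` and
`u - φ` has at `x₀ ∈ Ω` a maximum over `B_δ(x₀)`, the inequality `≤ 0` holds at `x₀`, the
operator being evaluated on `φ` in `B_δ` and on `u` outside `B_δ`. -/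
def IsViscositySubsolution {d : ℕ} (K : E d → ℝ) (α : ℝ) (H : E d → E d → ℝ) (f u : E d → ℝ)
    (Ω : Set (E d)) : Prop :=
  ∀ x₀ ∈ Ω, ∀ δ > (0 : ℝ), ∀ φ : E d → ℝ, ContDiff ℝ 2 φ →
    (∀ x ∈ Metric.ball x₀ δ, u x - φ x ≤ u x₀ - φ x₀) →
    α * u x₀ - (nonlocalEval K (Metric.ball 0 δ) φ (gradient φ x₀) x₀
        + nonlocalEval K (Metric.ball 0 δ)ᶜ u (gradient φ x₀) x₀)
      + H x₀ (gradient φ x₀) - f x₀ ≤ 0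

/-- Viscosity supersolution: maxima are replaced by minima and the inequality is reversed. -/
def IsViscositySupersolution {d : ℕ} (K : E d → ℝ) (α : ℝ) (H : E d → E d → ℝ) (f u : E d → ℝ)
    (Ω : Set (E d)) : Prop :=
  ∀ x₀ ∈ Ω, ∀ δ > (0 : ℝ), ∀ φ : E d → ℝ, ContDiff ℝ 2 φ →
    (∀ x ∈ Metric.ball x₀ δ, u x₀ - φ x₀ ≤ u x - φ x) →
    0 ≤ α * u x₀ - (nonlocalEval K (Metric.ball 0 δ) φ (gradient φ x₀) x₀
        + nonlocalEval K (Metric.ball 0 δ)ᶜ u (gradient φ x₀) x₀)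
      + H x₀ (gradient φ x₀) - f x₀

/-- Viscosity solution: both a sub- and a supersolution. -/
def IsViscositySolution {d : ℕ} (K : E d → ℝ) (α : ℝ) (H : E d → E d → ℝ) (f u : E d → ℝ)
    (Ω : Set (E d)) : Prop :=
  IsViscositySubsolution K α H f u Ω ∧ IsViscositySupersolution K α H f u Ω

/-- Hypothesis (H1) with growth exponent `m` and constants `C_{H,R} = CH R > 0`. -/
def HypH1 {d : ℕ} (m : ℝ) (CH : ℝ → ℝ) (H : E d → E d → ℝ) : Prop :=
  ∀ R > (0 : ℝ), 0 < CH R ∧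
    ∀ x ∈ Metric.ball (0 : E d) R, ∀ y ∈ Metric.ball (0 : E d) R, ∀ p q : E d, ‖q‖ ≤ R →
      |H x (p + q) - H y p| ≤
        CH R * (‖x - y‖ * (1 + ‖p‖ ^ m) + ‖q‖ * (‖p‖ ^ (m - 1) + ‖q‖ ^ (m - 1)))

/-- Hypothesis (H2): coercivity of `H` in the gradient variable, with constant `κ`. -/
def HypH2 {d : ℕ} (m κ : ℝ) (H : E d → E d → ℝ) : Prop :=
  ∀ x p : E d, 1 / κ * ‖p‖ ^ m - κ ≤ H x p

/-- The standing assumptions on `K`, `α`, `f` and `H`; (H2) is imposed only when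
`m ≥ 2s + 1`. -/
structure Admissible (d : ℕ) (s m lam Lam κ : ℝ) (K : E d → ℝ) (α : ℝ) (H : E d → E d → ℝ)
    (CH : ℝ → ℝ) (f : E d → ℝ) : Prop where
  measurable_kernel : AEMeasurable K volume
  elliptic : IsElliptic d s lam Lam K
  alpha_nonneg : 0 ≤ α
  continuous_f : Continuous f
  continuous_H : Continuous (fun z : E d × E d => H z.1 z.2)
  hypH1 : HypH1 m CH H
  hypH2 : 2 * s + 1 ≤ m → HypH2 m κ H

/-- `osc_A u = sup_A u - inf_A u`. -/
def osc {d : ℕ} (u : E d → ℝ) (A : Set (E d)) : ℝ := sSup (u '' A) - sInf (u '' A)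

/-- `ℋ(u, A, a) = sup_{x ∈ A} ∫ |u(x+y) - u(x)| / (a + |y|^{d+2s}) dy`. -/
def tail {d : ℕ} (s : ℝ) (u : E d → ℝ) (A : Set (E d)) (a : ℝ) : ℝ :=
  sSup ((fun x => ∫ y : E d, |u (x + y) - u x| / (a + ‖y‖ ^ ((d : ℝ) + 2 * s))) '' A)

/-- `A_R = 1 + sup_{B_{R+2}} f⁺ - α inf_{B_{R+2}} u⁻ + ℋ(u, B_{R+2}, 1)`, with the conventions
`a⁺ = max {a, 0}` and `a⁻ = min {a, 0}`. -/
def constA {d : ℕ} (s α : ℝ) (f u : E d → ℝ) (R : ℝ) : ℝ :=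
  1 + sSup ((fun x => max (f x) 0) '' Metric.ball (0 : E d) (R + 2))
    - α * sInf ((fun x => min (u x) 0) '' Metric.ball (0 : E d) (R + 2))
    + tail s u (Metric.ball (0 : E d) (R + 2)) 1

/-- `γ₀ = (m - 2s) / (m - 1)`. -/
def gammaZero (s m : ℝ) : ℝ := (m - 2 * s) / (m - 1)

/-- `ρ^{1-γ₀} (A_R^{1/m} + osc_{B_{R+2}} u)`; this is `ℨ₁` with the radius factor `ρ`. -/
def zetaOne {d : ℕ} (s m α : ℝ) (f u : E d → ℝ) (R ρ : ℝ) : ℝ :=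
  ρ ^ (1 - gammaZero s m) *
    (constA s α f u R ^ (1 / m) + osc u (Metric.ball (0 : E d) (R + 2)))

/-- `ℨ₂ = 1 + osc_{B_{R+2}} u + osc_{B_{R+2}} f + ℋ(u, B_{R+2}, 1)`. -/
def zetaTwo {d : ℕ} (s : ℝ) (f u : E d → ℝ) (R : ℝ) : ℝ :=
  1 + osc u (Metric.ball (0 : E d) (R + 2)) + osc f (Metric.ball (0 : E d) (R + 2))
    + tail s u (Metric.ball (0 : E d) (R + 2)) 1

/-- `u` is Lipschitz continuous on the ball `B_R` with the constant `L > 0`. -/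
def IsLipschitzOnBall {d : ℕ} (u : E d → ℝ) (R L : ℝ) : Prop :=
  0 < L ∧ ∀ x ∈ Metric.ball (0 : E d) R, ∀ y ∈ Metric.ball (0 : E d) R,
    |u x - u y| ≤ L * ‖x - y‖

end NonlocalHJ

end

noncomputable section

namespace NonlocalHJ

open Metric Set
open scoped Pointwise

variable {d : ℕ}

/-! ### Integrals of powers of the norm -/

/-! The argument is the Ishii–Lions doubling of variables, adapted to a kernel without symmetry.
Suppose the Lipschitz bound with constant `L` fails near `x₀`. Penalising `u x - u y` by `L *
profile θ ‖x - y‖` and a paraboloid centred at `x₀` yields a maximum point `(x, y)` with `r = ‖x -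
y‖ > 0` (`exists_doubling_point`). Subtract the supersolution inequality at `y` from the subsolution
inequality at `x`. The test gradients are `p + q` and `p`, so the first-order compensators cancel up
to the bounded vector `q`.

Near the origin, moving `x` and `y` by the same `z` bounds the integrand by a harmless quadratic.
For `z` close to `(x - y) / 4`, moving `x` alone and `y` alone produces a second difference of the
strictly concave profile, a negative amount of size `L * r ^ (1 + θ)`. Integrated against `K` on a
ball of radius comparable to `r ^ (1 + θ)`, this gives a gain of order `L * r ^ (1 - 2 * s + θ * (1
+ d))` (`nonlocalEval_sub_le`). By (H1) all remaining terms are at most a constant times `(1 + CH (R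
+ 2)) * Z * L ^ (m - 1)`; this is `exists_doubling_inequality`.

It remains to know that `r` is small. If `m < 2 * s + 1`, the trivial bound `r ≤ 2 * Z / L` suffices
(`exists_lipschitz_const_of_lt`). If `2 * s + 1 ≤ m`, coercivity first makes subsolutions Hölder of
order `gammaZero s m` (`exists_holder_const`), and this stronger smallness of `r` closes the
argument (`exists_lipschitz_const_of_le`). In both cases a large multiple of the claimed `L`
contradicts the doubling inequality.

For the variant with `zetaOne` at `ρ = R`, only `R ≤ 1` is new: there the supersolution property
bounds `constA` by a power of `zetaTwo` (`exists_constA_le`). -/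

lemma integrableOn_ball_rpow (hd : 1 ≤ d) {e : ℝ} (he : -(d : ℝ) < e) (ρ : ℝ) :
    IntegrableOn (fun z : E d => ‖z‖ ^ e) (ball 0 ρ) := by
  have h1 : Module.finrank ℝ (E d) = d := finrank_euclideanSpace_fin
  refine integrableOn_ball_of_norm_le_rpow (C := 1) (α := -e) (by rw [h1]; exact hd)
    (by rw [h1]; linarith) ?_ ?_
  · filter_upwards with x
    rw [Real.norm_of_nonneg (by positivity), neg_neg, one_mul]
  · exact (measurable_norm.pow_const e).aestronglyMeasurable

lemma integrableOn_compl_ball_rpow {e : ℝ} (he : e < -(d : ℝ)) {ρ : ℝ} (hρ : 0 < ρ) :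
    IntegrableOn (fun z : E d => ‖z‖ ^ e) (ball 0 ρ)ᶜ := by
  have h1 : Module.finrank ℝ (E d) = d := finrank_euclideanSpace_fin
  have h2 : Integrable (fun z : E d => (1 + ‖z‖) ^ (-(-e))) :=
    integrable_one_add_norm (by rw [h1]; linarith)
  have hdn : (0 : ℝ) ≤ d := d.cast_nonneg
  refine Integrable.mono' (h2.integrableOn.const_mul ((ρ / (1 + ρ)) ^ e))
    (measurable_norm.pow_const e).aestronglyMeasurable ?_
  refine (ae_restrict_iff' measurableSet_ball.compl).2 (.of_forall fun z hz => ?_)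
  have hz : ρ ≤ ‖z‖ := by simpa using hz
  rw [Real.norm_of_nonneg (by positivity), neg_neg, ← Real.mul_rpow (by positivity) (by positivity)]
  refine Real.rpow_le_rpow_of_nonpos (by positivity) ?_ (by linarith)
  rw [div_mul_eq_mul_div, div_le_iff₀ (by positivity)]
  nlinarith

lemma setIntegral_ball_rpow (e : ℝ) {ρ : ℝ} (hρ : 0 < ρ) :
    ∫ z in ball (0 : E d) ρ, ‖z‖ ^ e = ρ ^ ((d : ℝ) + e) * ∫ z in ball (0 : E d) 1, ‖z‖ ^ e := by
  have h := Measure.setIntegral_comp_smul_of_pos (volume : Measure (E d))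
    (fun z => ‖z‖ ^ e) (ball 0 1) hρ
  rw [smul_unitBall_of_pos hρ, finrank_euclideanSpace_fin] at h
  have h2 : ∀ z : E d, ‖ρ • z‖ ^ e = ρ ^ e * ‖z‖ ^ e := fun z => by
    rw [norm_smul, Real.norm_of_nonneg hρ.le, Real.mul_rpow hρ.le (norm_nonneg z)]
  simp only [h2, integral_const_mul, smul_eq_mul] at h
  rw [Real.rpow_add hρ, Real.rpow_natCast, mul_assoc, h, mul_inv_cancel_left₀ (by positivity)]

lemma setIntegral_compl_ball_rpow (e : ℝ) {ρ : ℝ} (hρ : 0 < ρ) :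
    ∫ z in (ball (0 : E d) ρ)ᶜ, ‖z‖ ^ e
      = ρ ^ ((d : ℝ) + e) * ∫ z in (ball (0 : E d) 1)ᶜ, ‖z‖ ^ e := by
  have h := Measure.setIntegral_comp_smul_of_pos (volume : Measure (E d))
    (fun z => ‖z‖ ^ e) (ball 0 1)ᶜ hρ
  have h3 : ρ • (ball (0 : E d) 1)ᶜ = (ball 0 ρ)ᶜ := by
    rw [compl_eq_univ_sdiff, smul_set_sdiff₀ hρ.ne', smul_set_univ₀ hρ.ne',
      smul_unitBall_of_pos hρ, ← compl_eq_univ_sdiff]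
  rw [h3, finrank_euclideanSpace_fin] at h
  have h2 : ∀ z : E d, ‖ρ • z‖ ^ e = ρ ^ e * ‖z‖ ^ e := fun z => by
    rw [norm_smul, Real.norm_of_nonneg hρ.le, Real.mul_rpow hρ.le (norm_nonneg z)]
  simp only [h2, integral_const_mul, smul_eq_mul] at h
  rw [Real.rpow_add hρ, Real.rpow_natCast, mul_assoc, h, mul_inv_cancel_left₀ (by positivity)]

/-! ### The weighted space -/

lemma one_add_rpow_le {a t : ℝ} (ha : 0 ≤ a) (ht : 0 ≤ t) :
    (1 + t) ^ a ≤ 2 ^ a * (1 + t ^ a) := by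
  have h : (1 + t) ≤ 2 * max 1 t := by
    have := le_max_left 1 t
    have := le_max_right 1 t
    linarith
  calc (1 + t) ^ a ≤ (2 * max 1 t) ^ a := Real.rpow_le_rpow (by positivity) h ha
    _ = 2 ^ a * (max 1 t) ^ a := Real.mul_rpow (by norm_num) (by positivity)
    _ ≤ _ := by
      gcongr
      rcases max_cases 1 t with ⟨h, _⟩ | ⟨h, _⟩ <;> rw [h]
      · rw [Real.one_rpow]
        have : 0 ≤ t ^ a := by positivity
        linarith
      · linarith

/-- The weight changes only by a bounded factor under translation by `x` in a bounded set, because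
`1 + ‖x + z‖ ≤ (1 + r) * (1 + ‖z‖)`. This keeps translates of `u` in the weighted space, with
uniform bounds. -/
lemma weight_le {s : ℝ} (hs : 0 < s) {r : ℝ} {x : E d} (hx : ‖x‖ ≤ r) (z : E d) :
    (1 + ‖z‖ ^ ((d : ℝ) + 2 * s))⁻¹ ≤
      2 * (2 * (1 + r)) ^ ((d : ℝ) + 2 * s) * (1 + ‖x + z‖ ^ ((d : ℝ) + 2 * s))⁻¹ := by
  set a : ℝ := (d : ℝ) + 2 * s
  have ha : 0 ≤ a := by positivity
  have hr : 0 ≤ r := (norm_nonneg x).trans hx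
  have h1 : ‖x + z‖ ≤ r + ‖z‖ := (norm_add_le x z).trans (by linarith)
  have h2 : 1 + ‖x + z‖ ^ a ≤ 2 * (1 + ‖x + z‖) ^ a := by
    have : ‖x + z‖ ^ a ≤ (1 + ‖x + z‖) ^ a :=
      Real.rpow_le_rpow (norm_nonneg _) (by linarith) ha
    have : 1 ≤ (1 + ‖x + z‖) ^ a :=
      Real.one_le_rpow (by linarith [norm_nonneg (x + z)]) ha
    linarith
  have h3 : (1 + ‖x + z‖) ^ a ≤ (1 + r) ^ a * (1 + ‖z‖) ^ a := by
    rw [← Real.mul_rpow (by positivity) (by positivity)]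
    refine Real.rpow_le_rpow (by positivity) ?_ ha
    nlinarith [norm_nonneg z]
  have h4 := one_add_rpow_le ha (norm_nonneg z)
  have hz : 0 < 1 + ‖z‖ ^ a := by positivity
  have hxz : 0 < 1 + ‖x + z‖ ^ a := by positivity
  rw [← div_eq_mul_inv, inv_eq_one_div, div_le_div_iff₀ hz hxz, one_mul,
    Real.mul_rpow (by norm_num) (by positivity)]
  calc 1 + ‖x + z‖ ^ a ≤ 2 * ((1 + r) ^ a * (1 + ‖z‖) ^ a) := by linarith
    _ ≤ 2 * ((1 + r) ^ a * (2 ^ a * (1 + ‖z‖ ^ a))) := by gcongr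
    _ = _ := by ring

lemma integrable_weight {s : ℝ} (hs : 0 < s) :
    Integrable (fun z : E d => (1 + ‖z‖ ^ ((d : ℝ) + 2 * s))⁻¹) := by
  set a : ℝ := (d : ℝ) + 2 * s with ha_def
  have ha : 0 ≤ a := by positivity
  have h1 : Module.finrank ℝ (E d) = d := finrank_euclideanSpace_fin
  have h2 : Integrable (fun z : E d => (1 + ‖z‖) ^ (-a)) :=
    integrable_one_add_norm (by rw [h1]; linarith)
  refine Integrable.mono' (h2.const_mul (2 ^ a))
    (((measurable_norm.pow_const a).const_add 1).inv).aestronglyMeasurable (.of_forall fun z => ?_)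
  rw [Real.norm_of_nonneg (by positivity), Real.rpow_neg (by positivity), ← div_eq_mul_inv,
    inv_eq_one_div, div_le_div_iff₀ (by positivity) (by positivity), one_mul]
  exact one_add_rpow_le ha (norm_nonneg z)

lemma integrable_translate_mul_weight {s : ℝ} (hs : 0 < s) {u : E d → ℝ} (hu : Continuous u)
    (hL : MemL1Weighted d s u) {r : ℝ} {x : E d} (hx : ‖x‖ ≤ r) :
    Integrable (fun z => |u (x + z)| * (1 + ‖z‖ ^ ((d : ℝ) + 2 * s))⁻¹) ∧
    ∫ z, |u (x + z)| * (1 + ‖z‖ ^ ((d : ℝ) + 2 * s))⁻¹ ≤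
      2 * (2 * (1 + r)) ^ ((d : ℝ) + 2 * s) * ∫ z, |u z| * (1 + ‖z‖ ^ ((d : ℝ) + 2 * s))⁻¹ := by
  have h1 := (hL.2.comp_add_left x).const_mul (2 * (2 * (1 + r)) ^ ((d : ℝ) + 2 * s))
  have h2 : ∀ z, |u (x + z)| * (1 + ‖z‖ ^ ((d : ℝ) + 2 * s))⁻¹ ≤
      2 * (2 * (1 + r)) ^ ((d : ℝ) + 2 * s) *
        (|u (x + z)| * (1 + ‖x + z‖ ^ ((d : ℝ) + 2 * s))⁻¹) := fun z => by
    have := mul_le_mul_of_nonneg_left (weight_le hs hx z) (abs_nonneg (u (x + z)))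
    linarith
  have h3 : Integrable (fun z => |u (x + z)| * (1 + ‖z‖ ^ ((d : ℝ) + 2 * s))⁻¹) := by
    refine Integrable.mono' h1 ?_ (.of_forall fun z => ?_)
    · exact ((hu.comp (continuous_const.add continuous_id)).abs.measurable.mul
        (((measurable_norm.pow_const _).const_add 1).inv)).aestronglyMeasurable
    · rw [Real.norm_of_nonneg (by positivity)]
      exact h2 z
  refine ⟨h3, (integral_mono h3 h1 h2).trans (le_of_eq ?_)⟩
  rw [integral_const_mul]
  congr 1
  exact integral_add_left_eq_self (μ := volume)
    (fun z => |u z| * (1 + ‖z‖ ^ ((d : ℝ) + 2 * s))⁻¹) x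

/-- The integrand in the definition of `tail`. -/
def tailIntegrand (s : ℝ) (u : E d → ℝ) (x z : E d) : ℝ :=
  |u (x + z) - u x| / (1 + ‖z‖ ^ ((d : ℝ) + 2 * s))

lemma tailIntegrand_nonneg (s : ℝ) (u : E d → ℝ) (x z : E d) : 0 ≤ tailIntegrand s u x z := by
  unfold tailIntegrand; positivity

lemma integrable_tailIntegrand {s : ℝ} (hs : 0 < s) {u : E d → ℝ} (hu : Continuous u)
    (hL : MemL1Weighted d s u) {r : ℝ} {x : E d} (hx : ‖x‖ ≤ r) :
    Integrable (tailIntegrand s u x) ∧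
    ∫ z, tailIntegrand s u x z ≤
      2 * (2 * (1 + r)) ^ ((d : ℝ) + 2 * s) * (∫ z, |u z| * (1 + ‖z‖ ^ ((d : ℝ) + 2 * s))⁻¹)
        + |u x| * ∫ z : E d, (1 + ‖z‖ ^ ((d : ℝ) + 2 * s))⁻¹ := by
  obtain ⟨h1, h2⟩ := integrable_translate_mul_weight hs hu hL hx
  have h3 := (integrable_weight (d := d) hs).const_mul |u x|
  have h4 : ∀ z, tailIntegrand s u x z ≤ |u (x + z)| * (1 + ‖z‖ ^ ((d : ℝ) + 2 * s))⁻¹ +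
      |u x| * (1 + ‖z‖ ^ ((d : ℝ) + 2 * s))⁻¹ := fun z => by
    rw [tailIntegrand, div_eq_mul_inv, ← add_mul]
    gcongr
    exact abs_sub _ _
  have h5 : Integrable (tailIntegrand s u x) := by
    refine Integrable.mono' (h1.add h3) ?_ (.of_forall fun z => ?_)
    · exact ((((hu.comp (continuous_const.add continuous_id)).sub
        continuous_const).abs.measurable).div
        (((measurable_norm.pow_const _).const_add 1))).aestronglyMeasurable
    · rw [Real.norm_of_nonneg (tailIntegrand_nonneg s u x z)]
      exact h4 z
  refine ⟨h5, (integral_mono h5 (h1.add h3) h4).trans ?_⟩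
  rw [Pi.add_def, integral_add h1 h3, integral_const_mul]
  linarith

lemma bddAbove_image_ball {g : E d → ℝ} (hg : Continuous g) (x : E d) (r : ℝ) :
    BddAbove (g '' ball x r) :=
  ((isCompact_closedBall x r).bddAbove_image hg.continuousOn).mono
    (image_mono ball_subset_closedBall)

lemma bddBelow_image_ball {g : E d → ℝ} (hg : Continuous g) (x : E d) (r : ℝ) :
    BddBelow (g '' ball x r) :=
  ((isCompact_closedBall x r).bddBelow_image hg.continuousOn).mono
    (image_mono ball_subset_closedBall)

lemma sub_le_osc {g : E d → ℝ} (hg : Continuous g) {r : ℝ} {x y : E d} (hx : x ∈ ball (0 : E d) r)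
    (hy : y ∈ ball (0 : E d) r) : g x - g y ≤ osc g (ball 0 r) :=
  sub_le_sub (le_csSup (bddAbove_image_ball hg 0 r) (mem_image_of_mem g hx))
    (csInf_le (bddBelow_image_ball hg 0 r) (mem_image_of_mem g hy))

lemma osc_nonneg {g : E d → ℝ} (hg : Continuous g) {r : ℝ} (hr : 0 < r) :
    0 ≤ osc g (ball (0 : E d) r) := by
  simpa using sub_le_osc hg (mem_ball_self hr) (mem_ball_self hr)

/-- `tail` is a real `sSup`, meaningful only for a bounded set; the uniform bound over the ball
supplies the boundedness. -/
lemma integral_tailIntegrand_le_tail {s : ℝ} (hs : 0 < s) {u : E d → ℝ} (hu : Continuous u)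
    (hL : MemL1Weighted d s u) {r : ℝ} {x : E d} (hx : x ∈ ball (0 : E d) r) :
    ∫ z, tailIntegrand s u x z ≤ tail s u (ball 0 r) 1 := by
  refine le_csSup ?_ (mem_image_of_mem _ hx)
  obtain ⟨B, hB⟩ := bddAbove_image_ball hu.abs 0 r
  refine ⟨2 * (2 * (1 + r)) ^ ((d : ℝ) + 2 * s) * (∫ z, |u z| * (1 + ‖z‖ ^ ((d : ℝ) + 2 * s))⁻¹)
        + B * ∫ z : E d, (1 + ‖z‖ ^ ((d : ℝ) + 2 * s))⁻¹, ?_⟩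
  rintro _ ⟨y, hy, rfl⟩
  refine (integrable_tailIntegrand hs hu hL (mem_ball_zero_iff.1 hy).le).2.trans ?_
  have h1 : |u y| ≤ B := hB (mem_image_of_mem (fun x => |u x|) hy)
  have h2 : 0 ≤ ∫ z : E d, (1 + ‖z‖ ^ ((d : ℝ) + 2 * s))⁻¹ :=
    integral_nonneg fun z => by positivity
  gcongr

lemma tail_nonneg (s : ℝ) (u : E d → ℝ) (A : Set (E d)) : 0 ≤ tail s u A 1 := by
  refine Real.sSup_nonneg ?_
  rintro _ ⟨x, -, rfl⟩
  exact integral_nonneg fun z => tailIntegrand_nonneg s u x z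

lemma one_le_zetaTwo {s : ℝ} {f u : E d → ℝ} (hf : Continuous f) (hu : Continuous u) {R : ℝ}
    (hR : 0 < R) : 1 ≤ zetaTwo s f u R := by
  have := osc_nonneg hf (show 0 < R + 2 by linarith)
  have := osc_nonneg hu (show 0 < R + 2 by linarith)
  have := tail_nonneg s u (ball 0 (R + 2))
  unfold zetaTwo
  linarith

/-! ### Bounds on the kernel -/

section Kernel

variable {s lam Lam : ℝ} {K : E d → ℝ}

lemma IsElliptic.nonneg (hK : IsElliptic d s lam Lam K) (hlam : 0 < lam) {z : E d} (hz : z ≠ 0) :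
    0 ≤ K z :=
  le_trans (by positivity) (hK z hz).1

/-- Nothing is known about `K 0`; a positive power of `‖z‖` absorbs that value, so the bounds hold
everywhere and not just off the origin. -/
lemma IsElliptic.norm_pow_mul (hK : IsElliptic d s lam Lam K) (hlam : 0 < lam) (hLam : 0 ≤ Lam)
    {n : ℕ} (hn : n ≠ 0) (z : E d) :
    0 ≤ ‖z‖ ^ n * K z ∧ ‖z‖ ^ n * K z ≤ Lam * ‖z‖ ^ ((n : ℝ) - (d + 2 * s)) := by
  rcases eq_or_ne z 0 with rfl | hz
  · simp only [norm_zero, zero_pow hn, zero_mul, le_refl, true_and]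
    positivity
  · have hz' : 0 < ‖z‖ := norm_pos_iff.2 hz
    refine ⟨mul_nonneg (by positivity) (hK.nonneg hlam hz), ?_⟩
    calc ‖z‖ ^ n * K z ≤ ‖z‖ ^ n * (Lam * ‖z‖ ^ (-((d : ℝ) + 2 * s))) := by
          gcongr
          exact (hK z hz).2
      _ = _ := by
          rw [sub_eq_add_neg, Real.rpow_add hz', Real.rpow_natCast]
          ring

/-- `∫_{B_1} |z|^{2-d-2s} dz`. -/
def nearConst (d : ℕ) (s : ℝ) : ℝ := ∫ z in ball (0 : E d) 1, ‖z‖ ^ ((2 : ℕ) - ((d : ℝ) + 2 * s))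

/-- `∫_{B_1ᶜ} |z|^{1-d-2s} dz`. -/
def farConst (d : ℕ) (s : ℝ) : ℝ := ∫ z in (ball (0 : E d) 1)ᶜ, ‖z‖ ^ ((1 : ℕ) - ((d : ℝ) + 2 * s))

lemma nearConst_nonneg (d : ℕ) (s : ℝ) : 0 ≤ nearConst d s :=
  integral_nonneg fun z => by positivity

lemma farConst_nonneg (d : ℕ) (s : ℝ) : 0 ≤ farConst d s :=
  integral_nonneg fun z => by positivity

lemma integrableOn_sq_kernel (hd : 1 ≤ d) (hs' : s < 1) (hlam : 0 < lam) (hLam : 0 ≤ Lam)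
    (hKm : AEMeasurable K volume) (hK : IsElliptic d s lam Lam K) {ρ : ℝ} (hρ : 0 < ρ) :
    IntegrableOn (fun z => ‖z‖ ^ 2 * K z) (ball 0 ρ) ∧ 0 ≤ ∫ z in ball 0 ρ, ‖z‖ ^ 2 * K z ∧
    ∫ z in ball 0 ρ, ‖z‖ ^ 2 * K z ≤ Lam * nearConst d s * ρ ^ (2 - 2 * s) := by
  have h0 := fun z => hK.norm_pow_mul hlam hLam two_ne_zero z
  have h1 : IntegrableOn (fun z : E d => Lam * ‖z‖ ^ ((2 : ℕ) - ((d : ℝ) + 2 * s))) (ball 0 ρ) :=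
    (integrableOn_ball_rpow hd (by push_cast; linarith) ρ).const_mul Lam
  have h2 : IntegrableOn (fun z => ‖z‖ ^ 2 * K z) (ball 0 ρ) := by
    refine Integrable.mono' h1 ?_ (.of_forall fun z => ?_)
    · exact ((measurable_norm.pow_const 2).aemeasurable.mul hKm).aestronglyMeasurable.restrict
    · rw [Real.norm_of_nonneg (h0 z).1]
      exact (h0 z).2
  refine ⟨h2, integral_nonneg fun z => (h0 z).1,
    (integral_mono h2 h1 fun z => (h0 z).2).trans (le_of_eq ?_)⟩
  rw [integral_const_mul, setIntegral_ball_rpow _ hρ, nearConst]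
  have : (d : ℝ) + ((2 : ℕ) - ((d : ℝ) + 2 * s)) = 2 - 2 * s := by push_cast; ring
  rw [this]
  ring

/-- The first moment of the kernel at infinity is finite exactly because `2 * s > 1`. -/
lemma integrableOn_norm_kernel (hs : 1 / 2 < s) (hlam : 0 < lam) (hLam : 0 ≤ Lam)
    (hKm : AEMeasurable K volume) (hK : IsElliptic d s lam Lam K) {ρ : ℝ} (hρ : 0 < ρ) :
    IntegrableOn (fun z => ‖z‖ * K z) (ball 0 ρ)ᶜ ∧
    ∫ z in (ball 0 ρ)ᶜ, ‖z‖ * K z ≤ Lam * farConst d s * ρ ^ (1 - 2 * s) := by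
  have h0 : ∀ z, 0 ≤ ‖z‖ * K z ∧ ‖z‖ * K z ≤ Lam * ‖z‖ ^ ((1 : ℕ) - ((d : ℝ) + 2 * s)) :=
    fun z => by simpa using hK.norm_pow_mul hlam hLam one_ne_zero z
  have h1 : IntegrableOn (fun z : E d => Lam * ‖z‖ ^ ((1 : ℕ) - ((d : ℝ) + 2 * s))) (ball 0 ρ)ᶜ :=
    (integrableOn_compl_ball_rpow (by push_cast; linarith) hρ).const_mul Lam
  have h2 : IntegrableOn (fun z => ‖z‖ * K z) (ball 0 ρ)ᶜ := by
    refine Integrable.mono' h1 ?_ (.of_forall fun z => ?_)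
    · exact (measurable_norm.aemeasurable.mul hKm).aestronglyMeasurable.restrict
    · rw [Real.norm_of_nonneg (h0 z).1]
      exact (h0 z).2
  refine ⟨h2, (integral_mono h2 h1 fun z => (h0 z).2).trans (le_of_eq ?_)⟩
  rw [integral_const_mul, setIntegral_compl_ball_rpow _ hρ, farConst]
  have : (d : ℝ) + ((1 : ℕ) - ((d : ℝ) + 2 * s)) = 1 - 2 * s := by push_cast; ring
  rw [this]
  ring

lemma IsElliptic.le_weight (hK : IsElliptic d s lam Lam K) (hs : 0 < s) (hLam : 0 ≤ Lam) {ρ : ℝ}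
    (hρ : 0 < ρ) {z : E d} (hz : ρ ≤ ‖z‖) :
    K z ≤ Lam * (1 + ρ ^ (-((d : ℝ) + 2 * s))) * (1 + ‖z‖ ^ ((d : ℝ) + 2 * s))⁻¹ := by
  have hz0 : 0 < ‖z‖ := hρ.trans_le hz
  have h1 : ‖z‖ ^ (-((d : ℝ) + 2 * s)) ≤ ρ ^ (-((d : ℝ) + 2 * s)) :=
    Real.rpow_le_rpow_of_nonpos hρ hz (by
      have : (0 : ℝ) ≤ d := d.cast_nonneg
      linarith)
  refine (hK z (norm_pos_iff.1 hz0)).2.trans ?_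
  rw [mul_assoc]
  gcongr
  rw [← div_eq_mul_inv, le_div_iff₀ (by positivity), mul_add, ← Real.rpow_add hz0]
  simp only [neg_add_cancel, Real.rpow_zero]
  linarith

lemma integrableOn_tail_kernel (hs : 0 < s) (hlam : 0 < lam) (hLam : 0 ≤ Lam)
    (hKm : AEMeasurable K volume) (hK : IsElliptic d s lam Lam K) {u : E d → ℝ} (hu : Continuous u)
    (hL : MemL1Weighted d s u) (x : E d) {ρ : ℝ} (hρ : 0 < ρ) :
    IntegrableOn (fun z => |u (x + z) - u x| * K z) (ball 0 ρ)ᶜ ∧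
    ∫ z in (ball 0 ρ)ᶜ, |u (x + z) - u x| * K z ≤
      Lam * (1 + ρ ^ (-((d : ℝ) + 2 * s))) * ∫ z, tailIntegrand s u x z := by
  have h1 := (integrable_tailIntegrand hs hu hL le_rfl (x := x)).1
  have h2 := h1.const_mul (Lam * (1 + ρ ^ (-((d : ℝ) + 2 * s))))
  have h3 : ∀ᵐ z ∂(volume.restrict (ball (0 : E d) ρ)ᶜ), 0 ≤ |u (x + z) - u x| * K z ∧
      |u (x + z) - u x| * K z ≤
        Lam * (1 + ρ ^ (-((d : ℝ) + 2 * s))) * tailIntegrand s u x z := by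
    refine (ae_restrict_iff' measurableSet_ball.compl).2 (.of_forall fun z hz => ?_)
    have hz : ρ ≤ ‖z‖ := by simpa using hz
    refine ⟨mul_nonneg (abs_nonneg _) (hK.nonneg hlam (norm_pos_iff.1 (hρ.trans_le hz))), ?_⟩
    have := mul_le_mul_of_nonneg_left (hK.le_weight hs hLam hρ hz) (abs_nonneg (u (x + z) - u x))
    rw [tailIntegrand, div_eq_mul_inv]
    linarith
  have h4 : IntegrableOn (fun z => |u (x + z) - u x| * K z) (ball 0 ρ)ᶜ := by
    refine Integrable.mono' h2.integrableOn ?_ (h3.mono fun z hz => ?_)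
    · exact (((hu.comp (continuous_const.add continuous_id)).sub
        continuous_const).abs.measurable.aemeasurable.mul hKm).aestronglyMeasurable.restrict
    · rw [Real.norm_of_nonneg hz.1]
      exact hz.2
  refine ⟨h4, (integral_mono_ae h4 h2.integrableOn (h3.mono fun z hz => hz.2)).trans ?_⟩
  rw [← integral_const_mul]
  refine setIntegral_le_integral h2 (.of_forall fun z => ?_)
  exact mul_nonneg (by positivity) (tailIntegrand_nonneg s u x z)

lemma abs_indicator_inner_le (p z : E d) :
    |(ball (0 : E d) 1).indicator (fun z => inner ℝ z p) z| ≤ ‖p‖ * ‖z‖ := by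
  by_cases hz : z ∈ ball (0 : E d) 1
  · rw [indicator_of_mem hz, mul_comm]
    exact abs_real_inner_le_norm z p
  · rw [indicator_of_notMem hz, abs_zero]
    positivity

/-- A Bochner integral is `0` for a non-integrable function, so comparing two nonlocal evaluations
requires this. -/
lemma integrableOn_nonlocal (hs : 1 / 2 < s) (hlam : 0 < lam) (hLam : 0 ≤ Lam)
    (hKm : AEMeasurable K volume) (hK : IsElliptic d s lam Lam K) {u : E d → ℝ} (hu : Continuous u)
    (hL : MemL1Weighted d s u) (p x : E d) {ρ : ℝ} (hρ : 0 < ρ) :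
    IntegrableOn (fun y => (u (x + y) - u x -
      (ball (0 : E d) 1).indicator (fun z => inner ℝ z p) y) * K y) (ball 0 ρ)ᶜ := by
  have h1 := (integrableOn_tail_kernel (by linarith) hlam hLam hKm hK hu hL x hρ).1
  have h2 := (integrableOn_norm_kernel hs hlam hLam hKm hK hρ).1.const_mul ‖p‖
  refine Integrable.mono' (h1.add h2) ?_ ?_
  · have h3 : Measurable ((ball (0 : E d) 1).indicator (fun z => inner ℝ z p)) :=
      (by fun_prop : Measurable fun z : E d => inner ℝ z p).indicator measurableSet_ball
    exact ((((hu.comp (continuous_const.add continuous_id)).sub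
        continuous_const).measurable.sub h3).aemeasurable.mul hKm).aestronglyMeasurable.restrict
  · refine (ae_restrict_iff' measurableSet_ball.compl).2 (.of_forall fun z hz => ?_)
    have hz : ρ ≤ ‖z‖ := by simpa using hz
    have hKz := hK.nonneg hlam (norm_pos_iff.1 (hρ.trans_le hz))
    rw [norm_mul, Real.norm_of_nonneg hKz, Real.norm_eq_abs]
    simp only [Pi.add_apply]
    rw [← mul_assoc, ← add_mul]
    refine mul_le_mul_of_nonneg_right ?_ hKz
    exact (abs_sub _ _).trans (add_le_add le_rfl (abs_indicator_inner_le p z))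

end Kernel

/-! ### Quadratic test functions -/

section Touching

variable {K : E d → ℝ} {α : ℝ} {H : E d → E d → ℝ} {f u : E d → ℝ} {Ω : Set (E d)}

/-- The quadratic polynomial with gradient `p` at `x` and leading part `k |· - x|²`. -/
def quadratic (x p : E d) (k : ℝ) (y : E d) : ℝ := inner ℝ p (y - x) + k * ‖y - x‖ ^ 2

lemma contDiff_quadratic (x p : E d) (k : ℝ) : ContDiff ℝ 2 (quadratic x p k) := by
  unfold quadratic
  exact (contDiff_const.inner ℝ (contDiff_id.sub contDiff_const)).add
    (contDiff_const.mul ((contDiff_id.sub contDiff_const).norm_sq ℝ))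

lemma gradient_quadratic (x p : E d) (k : ℝ) : gradient (quadratic x p k) x = p := by
  refine HasGradientAt.gradient (hasGradientAt_iff_hasFDerivAt.2 ?_)
  have h1 : HasFDerivAt (fun y : E d => y - x) (ContinuousLinearMap.id ℝ (E d)) x :=
    (hasFDerivAt_id x).sub_const x
  have h2 := ((innerSL ℝ p).hasFDerivAt.comp x h1).add ((h1.norm_sq).const_mul k)
  refine h2.congr_fderiv ?_
  ext z
  simp

/-- For `δ ≤ 1` the cutoff is identically one on the ball, so the compensator removes the whole
linear part and no symmetry of `K` is needed. -/
lemma nonlocalEval_quadratic (x p : E d) (k : ℝ) {δ : ℝ} (hδ : δ ≤ 1) :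
    nonlocalEval K (ball 0 δ) (quadratic x p k) p x = k * ∫ z in ball 0 δ, ‖z‖ ^ 2 * K z := by
  rw [nonlocalEval, ← integral_const_mul]
  refine setIntegral_congr_fun measurableSet_ball fun z hz => ?_
  simp only [quadratic]
  rw [indicator_of_mem (ball_subset_ball hδ hz), real_inner_comm]
  simp
  ring

/-- All test functions used later are paraboloids; this form of the subsolution condition hides the
derivative and the smoothness. -/
lemma IsViscositySubsolution.touch (h : IsViscositySubsolution K α H f u Ω) {x p : E d} {k δ : ℝ}
    (hx : x ∈ Ω) (hδ : 0 < δ) (hδ' : δ ≤ 1)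
    (hq : ∀ z, ‖z‖ < δ → u (x + z) - u x ≤ inner ℝ p z + k * ‖z‖ ^ 2) :
    α * u x + H x p - f x ≤
      k * (∫ z in ball 0 δ, ‖z‖ ^ 2 * K z) + nonlocalEval K (ball 0 δ)ᶜ u p x := by
  have h1 := h x hx δ hδ (quadratic x p k) (contDiff_quadratic x p k) fun y hy => by
    have := hq (y - x) (by rwa [← dist_eq_norm])
    rw [add_sub_cancel] at this
    simp only [quadratic, sub_self, inner_zero_right, norm_zero]
    linarith
  rw [gradient_quadratic, nonlocalEval_quadratic x p k hδ'] at h1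
  linarith

lemma IsViscositySupersolution.touch (h : IsViscositySupersolution K α H f u Ω) {x p : E d}
    {k δ : ℝ} (hx : x ∈ Ω) (hδ : 0 < δ) (hδ' : δ ≤ 1)
    (hq : ∀ z, ‖z‖ < δ → inner ℝ p z + k * ‖z‖ ^ 2 ≤ u (x + z) - u x) :
    k * (∫ z in ball 0 δ, ‖z‖ ^ 2 * K z) + nonlocalEval K (ball 0 δ)ᶜ u p x ≤
      α * u x + H x p - f x := by
  have h1 := h x hx δ hδ (quadratic x p k) (contDiff_quadratic x p k) fun y hy => by
    have := hq (y - x) (by rwa [← dist_eq_norm])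
    rw [add_sub_cancel] at this
    simp only [quadratic, sub_self, inner_zero_right, norm_zero]
    linarith
  rw [gradient_quadratic, nonlocalEval_quadratic x p k hδ'] at h1
  linarith

end Touching

/-! ### Consequences of the assumptions on the Hamiltonian -/

section Hamiltonian

variable {m : ℝ} {CH : ℝ → ℝ} {H : E d → E d → ℝ}

/-- Removes the restriction `‖q‖ ≤ R` of (H1): `q` is split into `n` equal steps of length at most
`R`. Along the path both powers in (H1) are at most `(‖p‖ + ‖q‖) ^ (m - 1)`, whence the factor `2`,
and the step lengths add up to `‖q‖`. -/
lemma HypH1.abs_sub_le_gradient (h : HypH1 m CH H) (hm : 1 ≤ m) {R : ℝ} (hR : 0 < R) {x : E d}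
    (hx : x ∈ ball (0 : E d) R) (p q : E d) :
    |H x (p + q) - H x p| ≤ 2 * CH R * (‖q‖ * (‖p‖ + ‖q‖) ^ (m - 1)) := by
  obtain ⟨hC, h1⟩ := h R hR
  set n : ℕ := ⌈‖q‖ / R⌉₊ + 1 with hn
  have hn0 : (0 : ℝ) < n := by positivity
  have hnR : ‖q‖ ≤ n * R := by
    rw [← div_le_iff₀ hR, hn]
    push_cast
    linarith [Nat.le_ceil (‖q‖ / R)]
  set v : E d := (n : ℝ)⁻¹ • q with hv
  have hvn : ‖v‖ = ‖q‖ / n := by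
    rw [hv, norm_smul, norm_inv, Real.norm_of_nonneg hn0.le, inv_mul_eq_div]
  have hn1 : (1 : ℝ) ≤ n := by rw [hn]; push_cast; linarith [Nat.cast_nonneg (α := ℝ) ⌈‖q‖ / R⌉₊]
  have hvq : ‖v‖ ≤ ‖q‖ := by rw [hvn]; exact div_le_self (norm_nonneg q) hn1
  have hvR : ‖v‖ ≤ R := by rw [hvn, div_le_iff₀ hn0]; linarith
  have key : ∀ k : ℕ, k ≤ n → |H x (p + (k : ℝ) • v) - H x p| ≤
      k * (2 * CH R * (‖v‖ * (‖p‖ + ‖q‖) ^ (m - 1))) := by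
    intro k
    induction k with
    | zero => intro _; simp
    | succ k ih =>
      intro hk
      have ih := ih (by omega)
      have h2 := h1 x hx x hx (p + (k : ℝ) • v) v hvR
      have h3 : p + (k : ℝ) • v + v = p + ((k + 1 : ℕ) : ℝ) • v := by
        push_cast; rw [add_smul, one_smul, add_assoc]
      rw [h3, sub_self, norm_zero, zero_mul, zero_add] at h2
      have hkn : ((k : ℕ) : ℝ) ≤ n := by exact_mod_cast (by omega : k ≤ n)
      have h4 : ‖p + (k : ℝ) • v‖ ≤ ‖p‖ + ‖q‖ := by
        refine (norm_add_le _ _).trans ?_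
        gcongr
        rw [norm_smul, Real.norm_of_nonneg (Nat.cast_nonneg k), hvn, mul_div_assoc',
          div_le_iff₀ hn0, mul_comm]
        gcongr
      have h5 : ‖p + (k : ℝ) • v‖ ^ (m - 1) ≤ (‖p‖ + ‖q‖) ^ (m - 1) :=
        Real.rpow_le_rpow (norm_nonneg _) h4 (by linarith)
      have h6 : ‖v‖ ^ (m - 1) ≤ (‖p‖ + ‖q‖) ^ (m - 1) :=
        Real.rpow_le_rpow (norm_nonneg _) (by linarith [norm_nonneg p]) (by linarith)
      have h7 : CH R * (‖v‖ * (‖p + (k : ℝ) • v‖ ^ (m - 1) + ‖v‖ ^ (m - 1))) ≤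
          CH R * (‖v‖ * ((‖p‖ + ‖q‖) ^ (m - 1) + (‖p‖ + ‖q‖) ^ (m - 1))) := by gcongr
      have h8 := abs_sub_le (H x (p + ((k + 1 : ℕ) : ℝ) • v)) (H x (p + (k : ℝ) • v)) (H x p)
      push_cast at *
      linarith
  have h2 := key n le_rfl
  have h3 : (n : ℝ) • v = q := by rw [hv, smul_smul, mul_inv_cancel₀ hn0.ne', one_smul]
  rw [h3, hvn] at h2
  refine h2.trans (le_of_eq ?_)
  field_simp

lemma HypH1.abs_sub_le (h : HypH1 m CH H) (hm : 1 ≤ m) {R : ℝ} (hR : 0 < R) {x y : E d}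
    (hx : x ∈ ball (0 : E d) R) (hy : y ∈ ball (0 : E d) R) (p q : E d) :
    |H x (p + q) - H y p| ≤
      CH R * (‖x - y‖ * (1 + ‖p‖ ^ m) + 2 * (‖q‖ * (‖p‖ + ‖q‖) ^ (m - 1))) := by
  have h1 := h.abs_sub_le_gradient hm hR hx p q
  have h2 := (h R hR).2 x hx y hy p 0 (by simpa using hR.le)
  rw [add_zero, norm_zero, zero_mul, add_zero] at h2
  have h3 := _root_.abs_sub_le (H x (p + q)) (H x p) (H y p)
  linarith

/-- (H1) bounds the growth of `H` in the gradient by `2 * CH R * t ^ m`, while (H2) forces growth `t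
^ m / κ`; letting `t` grow compares the coefficients. This is why no `max` with `1` is needed in the
coercive case. -/
lemma HypH1.lower_bound (h : HypH1 m CH H) (hd : 1 ≤ d) (hm : 1 ≤ m) {κ : ℝ} (hκ : 0 < κ)
    (h2 : HypH2 m κ H) {R : ℝ} (hR : 0 < R) : 1 / (2 * κ) ≤ CH R := by
  by_contra! hlt
  set ε : ℝ := 1 / κ - 2 * CH R with hε
  have hε0 : 0 < ε := by
    rw [hε]
    have : 1 / (2 * κ) = 1 / κ / 2 := by field_simp
    linarith
  set e : E d := EuclideanSpace.single ⟨0, hd⟩ 1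
  have he : ‖e‖ = 1 := by simp [e]
  set t : ℝ := max 1 ((κ + H 0 0) / ε + 1)
  have ht1 : 1 ≤ t := le_max_left _ _
  have ht2 : (κ + H 0 0) / ε + 1 ≤ t := le_max_right _ _
  have hte : ‖t • e‖ = t := by rw [norm_smul, he, mul_one, Real.norm_of_nonneg (by linarith)]
  have h3 := h.abs_sub_le_gradient hm hR (mem_ball_self hR) 0 (t • e)
  have h4 := h2 0 (t • e)
  rw [norm_zero, zero_add, zero_add, hte] at h3
  rw [hte] at h4
  have h5 : t * t ^ (m - 1) = t ^ m := by
    rw [← Real.rpow_one_add' (by linarith) (by linarith)]; congr 1; ring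
  rw [h5] at h3
  have h6 : t ≤ t ^ m := by simpa using Real.rpow_le_rpow_of_exponent_le ht1 hm
  have h7 := (abs_le.1 h3).2
  have h8 : ε * t ^ m ≤ κ + H 0 0 := by rw [hε]; linarith
  have h9 : ε * t ≤ κ + H 0 0 := (mul_le_mul_of_nonneg_left h6 hε0.le).trans h8
  have h10 : κ + H 0 0 < ε * t := by
    have := (div_lt_iff₀ hε0).1 (show (κ + H 0 0) / ε < t by linarith)
    linarith
  linarith

end Hamiltonian

/-! ### Elementary inequalities -/

lemma rpow_le_tangent {γ ρ t : ℝ} (hγ : 0 ≤ γ) (hγ' : γ ≤ 1) (hρ : 0 < ρ) (ht : 0 ≤ t) :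
    t ^ γ ≤ ρ ^ γ + γ * ρ ^ (γ - 1) * (t - ρ) := by
  have h1 := rpow_one_add_le_one_add_mul_self (s := t / ρ - 1)
    (by have : 0 ≤ t / ρ := by positivity
        linarith) hγ hγ'
  rw [add_sub_cancel, Real.div_rpow ht hρ.le, div_le_iff₀ (by positivity)] at h1
  refine h1.trans (le_of_eq ?_)
  rw [Real.rpow_sub_one hρ.ne']
  field_simp

lemma tangent_le_rpow {e ρ t : ℝ} (he : 1 ≤ e) (hρ : 0 < ρ) (ht : 0 ≤ t) :
    ρ ^ e + e * ρ ^ (e - 1) * (t - ρ) ≤ t ^ e := by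
  have h1 := one_add_mul_self_le_rpow_one_add (s := t / ρ - 1)
    (by have : 0 ≤ t / ρ := by positivity
        linarith) he
  rw [add_sub_cancel, Real.div_rpow ht hρ.le, le_div_iff₀ (by positivity)] at h1
  refine le_trans (le_of_eq ?_) h1
  rw [Real.rpow_sub_one hρ.ne']
  field_simp

/-- Expand the square `(‖b + z‖ - ‖b‖) ^ 2 ≥ 0`. It supplies a paraboloid touching the norm from
above at `b`. -/
lemma norm_add_sub_norm_le {b : E d} (hb : b ≠ 0) (z : E d) :
    ‖b + z‖ - ‖b‖ ≤ (2 * inner ℝ b z + ‖z‖ ^ 2) / (2 * ‖b‖) := by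
  have hb' : 0 < ‖b‖ := norm_pos_iff.2 hb
  rw [le_div_iff₀ (by positivity)]
  have := norm_add_sq_real b z
  nlinarith [sq_nonneg (‖b + z‖ - ‖b‖)]

/-! ### Hölder estimate from coercivity -/

/-- The equation at a point where `u` is touched from above by `N |· - x₀|^γ`. -/
lemma subsolution_at_power_touching {s lam Lam : ℝ} {K : E d → ℝ} {α : ℝ} {H : E d → E d → ℝ}
    {f u : E d → ℝ} {Ω : Set (E d)} (hd : 1 ≤ d) (hs : 1 / 2 < s) (hs' : s < 1) (hlam : 0 < lam)
    (hLam : 0 ≤ Lam) (hKm : AEMeasurable K volume) (hK : IsElliptic d s lam Lam K)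
    (hu : Continuous u) (hL : MemL1Weighted d s u) (hsub : IsViscositySubsolution K α H f u Ω)
    {x b : E d} (hx : x ∈ Ω) (hb : b ≠ 0) (hb' : ‖b‖ ≤ 1 / 2) {N γ : ℝ} (hN : 0 ≤ N) (hγ : 0 ≤ γ)
    (hγ' : γ ≤ 1)
    (htouch : ∀ z, ‖z‖ ≤ 1 / 2 → u (x + z) - u x ≤ N * (‖b + z‖ ^ γ - ‖b‖ ^ γ)) :
    α * u x + H x ((N * γ * ‖b‖ ^ (γ - 2)) • b) - f x ≤
      Lam * (nearConst d s / 2 + 2 * farConst d s) * (N * γ * ‖b‖ ^ (γ - 2 * s)) +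
        Lam * (1 + (1 / 2) ^ (-((d : ℝ) + 2 * s))) * ∫ z, tailIntegrand s u x z := by
  set ρ : ℝ := ‖b‖ with hρ_def
  have hρ : 0 < ρ := norm_pos_iff.2 hb
  set p : E d := (N * γ * ρ ^ (γ - 2)) • b with hp_def
  set g : ℝ := N * γ * ρ ^ (γ - 1) with hg_def
  have hg : 0 ≤ g := by positivity
  have hpow : ρ ^ (γ - 2) * ρ = ρ ^ (γ - 1) := by
    rw [← Real.rpow_add_one hρ.ne']; congr 1; ring
  have hp : ‖p‖ = g := by
    rw [hp_def, norm_smul, Real.norm_of_nonneg (by positivity), ← hρ_def, hg_def, ← hpow]; ring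
  -- Concavity of `t ^ γ` replaces the power by its tangent, so only the norm remains to be
  -- estimated.
  have hlin : ∀ z, ‖z‖ ≤ 1 / 2 → u (x + z) - u x ≤ g * (‖b + z‖ - ρ) := fun z hz => by
    have h1 := rpow_le_tangent hγ hγ' hρ (norm_nonneg (b + z))
    calc u (x + z) - u x ≤ N * (‖b + z‖ ^ γ - ρ ^ γ) := htouch z hz
      _ ≤ N * (γ * ρ ^ (γ - 1) * (‖b + z‖ - ρ)) := by gcongr; linarith
      _ = _ := by rw [hg_def]; ring
  have hquad : ∀ z, ‖z‖ < ρ → u (x + z) - u x ≤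
      inner ℝ p z + (N * γ * ρ ^ (γ - 2) / 2) * ‖z‖ ^ 2 := fun z hz => by
    refine (hlin z (by linarith)).trans ((mul_le_mul_of_nonneg_left
      (norm_add_sub_norm_le hb z) hg).trans (le_of_eq ?_))
    rw [← hρ_def, hp_def, inner_smul_left, hg_def, ← hpow]
    simp only [conj_trivial]
    field_simp
  have h1 := hsub.touch hx hρ (by linarith) hquad
  obtain ⟨-, -, h2⟩ := integrableOn_sq_kernel hd hs' hlam hLam hKm hK hρ
  obtain ⟨h3, h4⟩ := integrableOn_norm_kernel hs hlam hLam hKm hK hρ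
  obtain ⟨h5, h6⟩ := integrableOn_tail_kernel (by linarith) hlam hLam hKm hK hu hL x
    (show (0 : ℝ) < 1 / 2 by norm_num)
  -- Between radii `ρ` and `1/2`, the increment and the compensator are each at most `g * ‖z‖`;
  -- beyond `1/2` the increment of `u` goes into the tail instead.
  have h7 : nonlocalEval K (ball 0 ρ)ᶜ u p x ≤ 2 * g * (Lam * farConst d s * ρ ^ (1 - 2 * s)) +
      Lam * (1 + (1 / 2) ^ (-((d : ℝ) + 2 * s))) * ∫ z, tailIntegrand s u x z := by
    have h8 : IntegrableOn ((ball (0 : E d) (1 / 2))ᶜ.indicator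
        (fun z => |u (x + z) - u x| * K z)) (ball 0 ρ)ᶜ :=
      ((integrable_indicator_iff measurableSet_ball.compl).2 h5).integrableOn
    have h9 : ∫ z in (ball 0 ρ)ᶜ, (ball (0 : E d) (1 / 2))ᶜ.indicator
        (fun z => |u (x + z) - u x| * K z) z = ∫ z in (ball (0 : E d) (1 / 2))ᶜ,
          |u (x + z) - u x| * K z := by
      rw [setIntegral_indicator measurableSet_ball.compl, inter_eq_self_of_subset_right]
      exact compl_subset_compl.2 (ball_subset_ball hb')
    refine le_trans (setIntegral_mono_on (integrableOn_nonlocal hs hlam hLam hKm hK hu hL p x hρ)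
      ((h3.const_mul (2 * g)).add h8) measurableSet_ball.compl fun z hz => ?_) ?_
    · have hz : ρ ≤ ‖z‖ := by simpa using hz
      have hKz := hK.nonneg hlam (norm_pos_iff.1 (hρ.trans_le hz))
      have hind := (abs_le.1 (abs_indicator_inner_le p z)).1
      rw [hp] at hind
      have hgz : 0 ≤ g * ‖z‖ := by positivity
      simp only [Pi.add_apply]
      by_cases hz2 : ‖z‖ < 1 / 2
      · have hz1 : z ∉ (ball (0 : E d) (1 / 2))ᶜ := by
          rw [mem_compl_iff, not_not, mem_ball_zero_iff]; exact hz2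
        rw [indicator_of_notMem hz1, add_zero, ← mul_assoc]
        refine mul_le_mul_of_nonneg_right ?_ hKz
        have hz3 := hlin z hz2.le
        have hz4 : g * (‖b + z‖ - ρ) ≤ g * ‖z‖ :=
          mul_le_mul_of_nonneg_left (by linarith [norm_add_le b z]) hg
        linarith
      · have hz1 : z ∈ (ball (0 : E d) (1 / 2))ᶜ := by
          rw [mem_compl_iff, mem_ball_zero_iff]; exact hz2
        rw [indicator_of_mem hz1, ← mul_assoc, ← add_mul]
        refine mul_le_mul_of_nonneg_right ?_ hKz
        linarith [le_abs_self (u (x + z) - u x)]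
    · simp only [Pi.add_apply]
      rw [integral_add (h3.const_mul (2 * g)) h8, h9, integral_const_mul]
      gcongr
  have h10 : N * γ * ρ ^ (γ - 2) / 2 * (∫ z in ball 0 ρ, ‖z‖ ^ 2 * K z) ≤
      N * γ * ρ ^ (γ - 2) / 2 * (Lam * nearConst d s * ρ ^ (2 - 2 * s)) := by gcongr
  have e1 : ρ ^ (γ - 2) * ρ ^ (2 - 2 * s) = ρ ^ (γ - 2 * s) := by
    rw [← Real.rpow_add hρ]; congr 1; ring
  have e2 : ρ ^ (γ - 1) * ρ ^ (1 - 2 * s) = ρ ^ (γ - 2 * s) := by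
    rw [← Real.rpow_add hρ]; congr 1; ring
  have e3 : N * γ * ρ ^ (γ - 2) / 2 * (Lam * nearConst d s * ρ ^ (2 - 2 * s)) =
      Lam * (nearConst d s / 2) * (N * γ * ρ ^ (γ - 2 * s)) := by rw [← e1]; ring
  have e4 : 2 * g * (Lam * farConst d s * ρ ^ (1 - 2 * s)) =
      Lam * (2 * farConst d s) * (N * γ * ρ ^ (γ - 2 * s)) := by rw [← e2, hg_def]; ring
  linarith

lemma gammaZero_mem {s m : ℝ} (hs : 1 / 2 < s) (hm : 2 * s + 1 ≤ m) :
    0 < gammaZero s m ∧ gammaZero s m < 1 := by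
  unfold gammaZero
  exact ⟨div_pos (by linarith) (by linarith), (div_lt_one (by linarith)).2 (by linarith)⟩

lemma one_sub_gammaZero {s m : ℝ} (hs : 1 / 2 < s) (hm : 2 * s + 1 ≤ m) :
    1 - gammaZero s m = (2 * s - 1) / (m - 1) := by
  have : m - 1 ≠ 0 := by linarith
  unfold gammaZero
  field_simp
  ring

lemma sSup_pos_part_nonneg (f : E d → ℝ) (r : ℝ) :
    0 ≤ sSup ((fun x => max (f x) 0) '' ball (0 : E d) r) :=
  Real.sSup_nonneg (by rintro _ ⟨x, -, rfl⟩; exact le_max_right _ _)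

lemma sInf_neg_part_nonpos (u : E d → ℝ) (r : ℝ) :
    sInf ((fun x => min (u x) 0) '' ball (0 : E d) r) ≤ 0 :=
  Real.sInf_nonpos (by rintro _ ⟨x, -, rfl⟩; exact min_le_right _ _)

lemma constA_bounds {s α : ℝ} (hα : 0 ≤ α) {f u : E d → ℝ} (hf : Continuous f) (hu : Continuous u)
    {R : ℝ} {x : E d} (hx : x ∈ ball (0 : E d) (R + 2)) :
    1 ≤ constA s α f u R ∧
      1 + f x - α * u x + tail s u (ball (0 : E d) (R + 2)) 1 ≤ constA s α f u R := by
  have h1 := sSup_pos_part_nonneg f (R + 2)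
  have h2 := sInf_neg_part_nonpos u (R + 2)
  have h3 := tail_nonneg s u (ball 0 (R + 2))
  have h4 : f x ≤ sSup ((fun x => max (f x) 0) '' ball (0 : E d) (R + 2)) :=
    (le_max_left _ _).trans (le_csSup (bddAbove_image_ball (hf.max continuous_const) 0 (R + 2))
      (mem_image_of_mem (fun x => max (f x) 0) hx))
  have h5 : sInf ((fun x => min (u x) 0) '' ball (0 : E d) (R + 2)) ≤ u x :=
    (csInf_le (bddBelow_image_ball (hu.min continuous_const) 0 (R + 2))
      (mem_image_of_mem (fun x => min (u x) 0) hx)).trans (min_le_left _ _)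
  have h6 := mul_nonneg hα (neg_nonneg.2 h2)
  have h7 := mul_le_mul_of_nonneg_left h5 hα
  unfold constA
  constructor <;> linarith

set_option maxHeartbeats 1000000 in
/-- Interior Hölder estimate for subsolutions of coercive equations. -/
lemma exists_holder_const {s m lam Lam κ : ℝ} (hd : 1 ≤ d) (hs : 1 / 2 < s)
    (hs' : s < 1) (hm : 2 * s + 1 ≤ m) (hlam : 0 < lam) (hLam : 0 ≤ Lam) (hκ : 0 < κ) :
    ∃ B : ℝ, 1 ≤ B ∧ ∀ (K : E d → ℝ) (α : ℝ) (H : E d → E d → ℝ) (CH : ℝ → ℝ) (f : E d → ℝ),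
      Admissible d s m lam Lam κ K α H CH f → ∀ (R : ℝ) (u : E d → ℝ), 0 < R → Continuous u →
      MemL1Weighted d s u → IsViscositySubsolution K α H f u (ball 0 (R + 2)) →
      ∀ x₀ ∈ ball (0 : E d) (R + 1), ∀ x, ‖x - x₀‖ ≤ 1 / 2 → u x - u x₀ ≤
        B * (constA s α f u R ^ (1 / m) + osc u (ball (0 : E d) (R + 2)))
          * ‖x - x₀‖ ^ gammaZero s m := by
  set γ := gammaZero s m with hγ_def
  obtain ⟨hγ0, hγ1⟩ := gammaZero_mem hs hm
  rw [← hγ_def] at hγ0 hγ1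
  set c₁ : ℝ := Lam * (nearConst d s / 2 + 2 * farConst d s) with hc₁
  set c₂ : ℝ := Lam * (1 + (1 / 2) ^ (-((d : ℝ) + 2 * s))) with hc₂
  have hc₁0 : 0 ≤ c₁ := by
    have := nearConst_nonneg d s
    have := farConst_nonneg d s
    positivity
  have hc₂0 : 0 ≤ c₂ := by positivity
  -- Chosen so that half of `D * X` plus half of `D * Aa` exceeds the right-hand side of `h7` below.
  set D : ℝ := 1 + 2 * κ * (κ + 1 + c₂) + 2 * κ * c₁ with hD
  have hD1 : 1 ≤ D := by
    have : 0 ≤ 2 * κ * (κ + 1 + c₂) := by positivity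
    have : 0 ≤ 2 * κ * c₁ := by positivity
    linarith
  refine ⟨D / γ + 2, by have : 0 ≤ D / γ := by positivity
                        linarith, ?_⟩
  intro K α H CH f hAd R u hR hu hL hsub x₀ hx₀ x₁ hx₁
  set Aa := constA s α f u R with hAa
  set O := osc u (ball (0 : E d) (R + 2)) with hO
  have hO0 : 0 ≤ O := osc_nonneg hu (by linarith)
  have hA1 : 1 ≤ Aa := (constA_bounds (s := s) hAd.alpha_nonneg hAd.continuous_f hu
    (mem_ball_self (by linarith : 0 < R + 2))).1
  have hm0 : 0 < m := by linarith
  have hAm : 1 ≤ Aa ^ (1 / m) := Real.one_le_rpow hA1 (by positivity)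
  -- The summand `D / γ` makes `N * γ ≥ D * Aa ^ (1 / m)`; the summand `2` makes `N ≥ 2 * O`, which
  -- keeps the maximum point within distance `1/2` of `x₀`.
  set N : ℝ := (D / γ + 2) * (Aa ^ (1 / m) + O) with hN
  have hDγ : 0 ≤ D / γ := by positivity
  have hN0 : 0 < N := by positivity
  have hball : closedBall x₀ 1 ⊆ ball (0 : E d) (R + 2) := fun y hy => by
    have h1 : ‖y - x₀‖ ≤ 1 := by simpa [dist_eq_norm] using hy
    have h2 : ‖x₀‖ < R + 1 := by simpa using hx₀
    have h3 : ‖y‖ ≤ ‖y - x₀‖ + ‖x₀‖ := by simpa using norm_add_le (y - x₀) x₀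
    rw [mem_ball_zero_iff]; linarith
  by_contra! hcon
  obtain ⟨x, hx, hmax⟩ := (isCompact_closedBall x₀ 1).exists_isMaxOn ⟨x₀, by simp⟩
    (f := fun y => u y - N * ‖y - x₀‖ ^ γ) (by
      refine (hu.sub (continuous_const.mul ?_)).continuousOn
      exact (continuous_norm.comp (continuous_id.sub continuous_const)).rpow_const
        fun _ => Or.inr hγ0.le)
  have hx₁' : x₁ ∈ closedBall x₀ 1 := by rw [mem_closedBall, dist_eq_norm]; linarith
  have h1 : u x₁ - N * ‖x₁ - x₀‖ ^ γ ≤ u x - N * ‖x - x₀‖ ^ γ := hmax hx₁'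
  set b := x - x₀ with hb_def
  have hb1 : ‖b‖ ≤ 1 := by simpa [dist_eq_norm] using hx
  have hux : N * ‖b‖ ^ γ < u x - u x₀ := by linarith
  have hb0 : b ≠ 0 := by
    intro h
    have hxx : x = x₀ := sub_eq_zero.1 h
    rw [hxx, h, norm_zero, Real.zero_rpow hγ0.ne'] at hux
    linarith
  have hbpos : 0 < ‖b‖ := norm_pos_iff.2 hb0
  have hbhalf : ‖b‖ ≤ 1 / 2 := by
    have h2 : u x - u x₀ ≤ O := sub_le_osc hu (hball hx) (hball (by simp))
    have h3 : ‖b‖ ≤ ‖b‖ ^ γ := by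
      simpa using Real.rpow_le_rpow_of_exponent_ge hbpos hb1 hγ1.le
    have h4 : 2 * O ≤ N := by
      rw [hN]
      exact mul_le_mul (by linarith) (by linarith) hO0 (by linarith)
    by_contra! h5
    have h6 : N * (1 / 2) < N * ‖b‖ ^ γ := mul_lt_mul_of_pos_left (by linarith) hN0
    linarith
  have htouch : ∀ z, ‖z‖ ≤ 1 / 2 → u (x + z) - u x ≤ N * (‖b + z‖ ^ γ - ‖b‖ ^ γ) := fun z hz => by
    have h2 : x + z - x₀ = b + z := by rw [hb_def]; abel
    have h3 : x + z ∈ closedBall x₀ 1 := by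
      rw [mem_closedBall, dist_eq_norm, h2]
      linarith [norm_add_le b z]
    have h4 : u (x + z) - N * ‖x + z - x₀‖ ^ γ ≤ u x - N * ‖b‖ ^ γ := hmax h3
    rw [h2] at h4
    linarith
  have h2 := subsolution_at_power_touching hd hs hs' hlam hLam hAd.measurable_kernel hAd.elliptic
    hu hL hsub (hball hx) hb0 hbhalf hN0.le hγ0.le hγ1.le htouch
  rw [← hc₁, ← hc₂] at h2
  have h3 := integral_tailIntegrand_le_tail (by linarith) hu hL (hball hx)
  have h4 := (constA_bounds (s := s) hAd.alpha_nonneg hAd.continuous_f hu (hball hx)).2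
  rw [← hAa] at h4
  have h5 := hAd.hypH2 hm x ((N * γ * ‖b‖ ^ (γ - 2)) • b)
  set X : ℝ := N * γ with hX
  have hX0 : 0 < X := by positivity
  have hpn : ‖(X * ‖b‖ ^ (γ - 2)) • b‖ = X * ‖b‖ ^ (γ - 1) := by
    rw [norm_smul, Real.norm_of_nonneg (by positivity), mul_assoc,
      ← Real.rpow_add_one hbpos.ne']
    congr 2; ring
  -- This identity characterises the Hölder exponent: the coercive term `‖∇‖ ^ m` and the nonlocal
  -- term scale with the same power of `‖b‖`.
  have hexp : (γ - 1) * m = γ - 2 * s := by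
    have h := one_sub_gammaZero hs hm
    rw [← hγ_def] at h
    have hm1 : m - 1 ≠ 0 := by linarith
    have h' : (1 - γ) * (m - 1) = 2 * s - 1 := by rw [h]; field_simp
    linarith
  rw [hpn, Real.mul_rpow hX0.le (by positivity), ← Real.rpow_mul hbpos.le, hexp] at h5
  set P : ℝ := ‖b‖ ^ (γ - 2 * s) with hP
  have hP1 : 1 ≤ P := Real.one_le_rpow_of_pos_of_le_one_of_nonpos hbpos hb1 (by linarith)
  have htail := tail_nonneg s u (ball 0 (R + 2))
  have h6 : 1 / κ * (X ^ m * P) ≤ c₁ * (X * P) + (κ + 1 + c₂) * Aa := by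
    have h7 : c₂ * ∫ z, tailIntegrand s u x z ≤ c₂ * tail s u (ball 0 (R + 2)) 1 := by gcongr
    have h8 : 1 + f x - α * u x ≤ Aa - tail s u (ball 0 (R + 2)) 1 := by linarith
    have h9 : tail s u (ball 0 (R + 2)) 1 ≤ Aa := by
      have h10 := (constA_bounds (s := s) hAd.alpha_nonneg hAd.continuous_f hu
        (mem_ball_self (by linarith : 0 < R + 2) (x := (0 : E d)))).2
      have h11 := sSup_pos_part_nonneg f (R + 2)
      have h12 := mul_nonneg hAd.alpha_nonneg (neg_nonneg.2 (sInf_neg_part_nonpos u (R + 2)))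
      rw [hAa, constA]; linarith
    have h10 : c₂ * tail s u (ball 0 (R + 2)) 1 ≤ c₂ * Aa := by gcongr
    have h11 : κ * 1 ≤ κ * Aa := by gcongr
    have h12 : c₁ * (X * P) = c₁ * (N * γ * P) := by rw [hX]
    linarith
  have h7 : X ^ m ≤ κ * c₁ * X + κ * (κ + 1 + c₂) * Aa := by
    have h8 : X ^ m * P ≤ (κ * c₁ * X + κ * (κ + 1 + c₂) * Aa) * P := by
      have h9 := mul_le_mul_of_nonneg_left h6 hκ.le
      rw [← mul_assoc, mul_one_div_cancel hκ.ne', one_mul] at h9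
      refine h9.trans ?_
      have h10 : κ * (κ + 1 + c₂) * Aa * 1 ≤ κ * (κ + 1 + c₂) * Aa * P := by gcongr
      linarith
    exact le_of_mul_le_mul_right h8 (by linarith)
  have hXD : D * Aa ^ (1 / m) ≤ X := by
    have h8 : D / γ * γ = D := by field_simp
    have h9 : X = D * (Aa ^ (1 / m) + O) + 2 * (Aa ^ (1 / m) + O) * γ := by
      rw [hX, hN]; linear_combination (Aa ^ (1 / m) + O) * h8
    have h10 : 0 ≤ D * O := by positivity
    have h11 : 0 ≤ 2 * (Aa ^ (1 / m) + O) * γ := by positivity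
    linarith
  have hXD1 : D ≤ X := (le_mul_of_one_le_right (by linarith) hAm).trans hXD
  have h8 : D * Aa ≤ X ^ m := by
    calc D * Aa ≤ D ^ m * Aa := by
          gcongr
          simpa using Real.rpow_le_rpow_of_exponent_le hD1 (by linarith : 1 ≤ m)
      _ = (D * Aa ^ (1 / m)) ^ m := by
          rw [Real.mul_rpow (by positivity) (by positivity), ← Real.rpow_mul (by positivity),
            one_div_mul_cancel hm0.ne', Real.rpow_one]
      _ ≤ X ^ m := Real.rpow_le_rpow (by positivity) hXD hm0.le
  -- Here `m ≥ 2` is used: the superlinear coercive term dominates the nonlocal term linear in `X`.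
  have h9 : D * X ≤ X ^ m := by
    have h10 : X ^ (2 : ℝ) ≤ X ^ m :=
      Real.rpow_le_rpow_of_exponent_le (by linarith) (by linarith)
    rw [Real.rpow_two, sq] at h10
    exact (mul_le_mul_of_nonneg_right hXD1 hX0.le).trans h10
  have h10 : 2 * κ * c₁ * X + X ≤ D * X := by
    have : 0 ≤ 2 * κ * (κ + 1 + c₂) * X := by positivity
    rw [hD]; linarith
  have h11 : 2 * κ * (κ + 1 + c₂) * Aa ≤ D * Aa := by
    have : 0 ≤ (1 + 2 * κ * c₁) * Aa := by positivity
    rw [hD]; linarith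
  linarith

/-! ### The concave profile `t - t^{1+θ}/4` -/

/-- The concave profile used in the doubling of variables. -/
def profile (θ t : ℝ) : ℝ := t - t ^ (1 + θ) / 4

/-- The derivative of `profile`. -/
def profileSlope (θ t : ℝ) : ℝ := 1 - (1 + θ) * t ^ θ / 4

/-- The concavity gap of `profile`, normalised. -/
def profileGap (θ : ℝ) : ℝ := (5 / 4) ^ (1 + θ) + (3 / 4) ^ (1 + θ) - 2

section Profile

variable {θ : ℝ}

lemma profile_zero (hθ : 0 < θ) : profile θ 0 = 0 := by
  rw [profile, Real.zero_rpow (by linarith)]; norm_num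

lemma profile_bounds (hθ : 0 < θ) {t : ℝ} (ht : 0 ≤ t) (ht' : t ≤ 1) :
    3 / 4 * t ≤ profile θ t ∧ profile θ t ≤ t := by
  have h1 : 0 ≤ t ^ (1 + θ) := by positivity
  have h2 : t ^ (1 + θ) ≤ t := by
    rcases ht.eq_or_lt with rfl | h
    · rw [Real.zero_rpow (by linarith)]
    · simpa using Real.rpow_le_rpow_of_exponent_ge h ht' (by linarith : 1 ≤ 1 + θ)
  unfold profile
  constructor <;> linarith

lemma profileSlope_bounds (hθ : 0 < θ) (hθ' : θ ≤ 1) {t : ℝ} (ht : 0 ≤ t) (ht' : t ≤ 1) :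
    1 / 2 ≤ profileSlope θ t ∧ profileSlope θ t ≤ 1 := by
  have h1 : 0 ≤ t ^ θ := by positivity
  have h2 : t ^ θ ≤ 1 := Real.rpow_le_one ht ht' hθ.le
  unfold profileSlope
  constructor <;> nlinarith

lemma profile_le_tangent (hθ : 0 < θ) {r t : ℝ} (hr : 0 < r) (ht : 0 ≤ t) :
    profile θ t ≤ profile θ r + profileSlope θ r * (t - r) := by
  have h1 := tangent_le_rpow (e := 1 + θ) (by linarith) hr ht
  rw [add_sub_cancel_left] at h1
  unfold profile profileSlope
  linarith

lemma profile_le_add (hθ : 0 < θ) (hθ' : θ ≤ 1) {r t η : ℝ} (hr : 0 < r) (hr' : r ≤ 1) (ht : 0 ≤ t)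
    (hη : 0 ≤ η) (h : t ≤ r + η) : profile θ t ≤ profile θ r + η := by
  obtain ⟨h1, h2⟩ := profileSlope_bounds hθ hθ' hr.le hr'
  refine (profile_le_tangent hθ hr ht).trans ?_
  have : profileSlope θ r * (t - r) ≤ profileSlope θ r * η :=
    mul_le_mul_of_nonneg_left (by linarith) (by linarith)
  have : profileSlope θ r * η ≤ 1 * η := mul_le_mul_of_nonneg_right h2 hη
  linarith

/-- Strict Bernoulli inequality at `1/4` and `-1/4`; the linear terms cancel. -/
lemma profileGap_pos (hθ : 0 < θ) : 0 < profileGap θ := by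
  have h1 := one_add_mul_self_lt_rpow_one_add (s := 1 / 4) (by norm_num) (by norm_num)
    (show 1 < 1 + θ by linarith)
  have h2 := one_add_mul_self_lt_rpow_one_add (s := -(1 / 4)) (by norm_num) (by norm_num)
    (show 1 < 1 + θ by linarith)
  have e1 : (1 : ℝ) + 1 / 4 = 5 / 4 := by norm_num
  have e2 : (1 : ℝ) + -(1 / 4) = 3 / 4 := by norm_num
  rw [e1] at h1
  rw [e2] at h2
  unfold profileGap
  linarith

lemma profileGap_le_one (hθ : 0 < θ) (hθ' : θ ≤ 1) : profileGap θ ≤ 1 := by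
  have h1 : (5 / 4 : ℝ) ^ (1 + θ) ≤ (5 / 4) ^ (2 : ℝ) :=
    Real.rpow_le_rpow_of_exponent_le (by norm_num) (by linarith)
  have h2 : (3 / 4 : ℝ) ^ (1 + θ) ≤ 1 := Real.rpow_le_one (by norm_num) (by norm_num) (by linarith)
  rw [Real.rpow_two] at h1
  unfold profileGap
  linarith

/-- The linear part cancels as `5/4 + 3/4 = 2`, and the rest is homogeneous of degree `1 + θ`. -/
lemma profile_second_difference {r : ℝ} (hr : 0 ≤ r) :
    profile θ (5 / 4 * r) + profile θ (3 / 4 * r) - 2 * profile θ r =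
      -(profileGap θ * r ^ (1 + θ) / 4) := by
  unfold profile profileGap
  rw [Real.mul_rpow (by norm_num) hr, Real.mul_rpow (by norm_num) hr]
  ring

end Profile

/-! ### Difference of the nonlocal terms at the doubling points -/

/-- The compensators differ only by `q`, and inside radius `1/4` the term `inner ℝ z q` in the
hypotheses cancels that difference. What is left is a gain on the ball around `z₀`, a quadratic
error near the origin, and tails. The bound does not depend on `δ`. -/
lemma nonlocalEval_sub_le {s lam Lam : ℝ} {K : E d → ℝ} {u : E d → ℝ} (hd : 1 ≤ d)
    (hs : 1 / 2 < s) (hs' : s < 1) (hlam : 0 < lam) (hLam : 0 ≤ Lam) (hKm : AEMeasurable K volume)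
    (hK : IsElliptic d s lam Lam K) (hu : Continuous u) (hL : MemL1Weighted d s u)
    {x y p q z₀ : E d} {M g r η δ : ℝ} (hM : 0 ≤ M) (hg : 0 ≤ g) (hr : r ≤ 1 / 4) (hη : 0 < η)
    (hδ : 0 < δ)
    (hD : ∀ z ∈ ball z₀ η, δ ≤ ‖z‖ ∧ ‖z‖ < r)
    (hnear : ∀ z, ‖z‖ < 1 / 4 → u (x + z) - u x - (u (y + z) - u y) ≤ inner ℝ z q + M * ‖z‖ ^ 2)
    (hgain : ∀ z ∈ ball z₀ η,
      u (x + z) - u x - (u (y + z) - u y) ≤ inner ℝ z q + M * ‖z‖ ^ 2 - g) :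
    nonlocalEval K (ball 0 δ)ᶜ u (p + q) x - nonlocalEval K (ball 0 δ)ᶜ u p y ≤
      -(g * lam * r ^ (-((d : ℝ) + 2 * s)) * (η ^ d * volume.real (ball (0 : E d) 1))) +
      M * (Lam * nearConst d s * (1 / 4) ^ (2 - 2 * s)) +
      (Lam * (1 + (1 / 4) ^ (-((d : ℝ) + 2 * s))) *
        ((∫ z, tailIntegrand s u x z) + ∫ z, tailIntegrand s u y z) +
      ‖q‖ * (Lam * farConst d s * (1 / 4) ^ (1 - 2 * s))) := by
  have h14 : (0 : ℝ) < 1 / 4 := by norm_num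
  set c : ℝ := g * lam * r ^ (-((d : ℝ) + 2 * s)) with hc
  have iG := (integrableOn_nonlocal hs hlam hLam hKm hK hu hL (p + q) x hδ).sub
    (integrableOn_nonlocal hs hlam hLam hKm hK hu hL p y hδ)
  obtain ⟨i1, -, b1⟩ := integrableOn_sq_kernel hd hs' hlam hLam hKm hK h14
  obtain ⟨i2, b2⟩ := integrableOn_tail_kernel (by linarith) hlam hLam hKm hK hu hL x h14
  obtain ⟨i3, b3⟩ := integrableOn_tail_kernel (by linarith) hlam hLam hKm hK hu hL y h14
  obtain ⟨i4, b4⟩ := integrableOn_norm_kernel hs hlam hLam hKm hK h14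
  -- `F₁` is the gain, `F₂` the quadratic error inside radius `1/4`, and `F₃` the contribution from
  -- outside.
  set F₁ : E d → ℝ := (ball z₀ η).indicator (fun _ => -c) with hF₁
  set F₂ : E d → ℝ := (ball (0 : E d) (1 / 4)).indicator (fun z => M * (‖z‖ ^ 2 * K z)) with hF₂
  set F₃ : E d → ℝ := (ball (0 : E d) (1 / 4))ᶜ.indicator (fun z =>
    (|u (x + z) - u x| * K z + |u (y + z) - u y| * K z) + ‖q‖ * (‖z‖ * K z)) with hF₃
  have j1 : Integrable F₁ := (integrable_indicator_iff measurableSet_ball).2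
    (integrableOn_const measure_ball_lt_top.ne)
  have j2 : Integrable F₂ := (integrable_indicator_iff measurableSet_ball).2 (i1.const_mul M)
  have j3 : Integrable F₃ := (integrable_indicator_iff measurableSet_ball.compl).2
    ((i2.add i3).add (i4.const_mul ‖q‖))
  have hF₂0 : ∀ z, 0 ≤ F₂ z := fun z => indicator_nonneg (fun z _ =>
    mul_nonneg hM (hK.norm_pow_mul hlam hLam two_ne_zero z).1) z
  have hF₃0 : ∀ z, 0 ≤ F₃ z := fun z => indicator_nonneg (fun z hz => by
    have hz : 1 / 4 ≤ ‖z‖ := by rwa [mem_compl_iff, mem_ball_zero_iff, not_lt] at hz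
    have := hK.nonneg hlam (norm_pos_iff.1 (h14.trans_le hz))
    positivity) z
  have hDsub : ball z₀ η ⊆ (ball (0 : E d) δ)ᶜ := fun z hz => by
    rw [mem_compl_iff, mem_ball_zero_iff, not_lt]; exact (hD z hz).1
  have k1 : ∫ z in (ball 0 δ)ᶜ, F₁ z = -(c * (η ^ d * volume.real (ball (0 : E d) 1))) := by
    rw [hF₁, setIntegral_indicator measurableSet_ball, inter_eq_self_of_subset_right hDsub,
      setIntegral_const, smul_eq_mul, measureReal_def, Measure.addHaar_ball_of_pos _ _ hη,
      finrank_euclideanSpace_fin, ENNReal.toReal_mul, ENNReal.toReal_ofReal (by positivity),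
      measureReal_def]
    ring
  have k2 : ∫ z in (ball 0 δ)ᶜ, F₂ z ≤ M * (Lam * nearConst d s * (1 / 4) ^ (2 - 2 * s)) := by
    refine (setIntegral_le_integral j2 (.of_forall hF₂0)).trans ?_
    rw [hF₂, integral_indicator measurableSet_ball, integral_const_mul]
    gcongr
  have k3 : ∫ z in (ball 0 δ)ᶜ, F₃ z ≤ Lam * (1 + (1 / 4) ^ (-((d : ℝ) + 2 * s))) *
        ((∫ z, tailIntegrand s u x z) + ∫ z, tailIntegrand s u y z) +
      ‖q‖ * (Lam * farConst d s * (1 / 4) ^ (1 - 2 * s)) := by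
    refine (setIntegral_le_integral j3 (.of_forall hF₃0)).trans ?_
    have i23 : IntegrableOn (fun z => |u (x + z) - u x| * K z + |u (y + z) - u y| * K z)
      (ball 0 (1 / 4))ᶜ := i2.add i3
    rw [hF₃, integral_indicator measurableSet_ball.compl,
      integral_add i23 (i4.const_mul ‖q‖), integral_add i2 i3, integral_const_mul]
    have := mul_le_mul_of_nonneg_left b4 (norm_nonneg q)
    linarith
  have hpt : ∀ z ∈ (ball (0 : E d) δ)ᶜ,
      (u (x + z) - u x - (ball (0 : E d) 1).indicator (fun w => inner ℝ w (p + q)) z) * K z -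
      (u (y + z) - u y - (ball (0 : E d) 1).indicator (fun w => inner ℝ w p) z) * K z ≤
        F₁ z + F₂ z + F₃ z := by
    intro z hz
    rw [mem_compl_iff, mem_ball_zero_iff, not_lt] at hz
    have hz0 : z ≠ 0 := norm_pos_iff.1 (hδ.trans_le hz)
    have hKz := hK.nonneg hlam hz0
    have e1 : (ball (0 : E d) 1).indicator (fun w => inner ℝ w (p + q)) z =
        (ball (0 : E d) 1).indicator (fun w => inner ℝ w p) z +
        (ball (0 : E d) 1).indicator (fun w => inner ℝ w q) z := by
      simp only [inner_add_right]
      rw [indicator_add]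
    rw [e1, ← sub_mul]
    by_cases hz1 : z ∈ ball (0 : E d) (1 / 4)
    · have hz2 : z ∈ ball (0 : E d) 1 := ball_subset_ball (by norm_num) hz1
      have e2 : F₃ z = 0 := indicator_of_notMem (not_not.2 hz1) _
      have e3 : F₂ z = M * (‖z‖ ^ 2 * K z) := indicator_of_mem hz1 _
      have e4 : (ball (0 : E d) 1).indicator (fun w => inner ℝ w q) z = inner ℝ z q :=
        indicator_of_mem hz2 _
      rw [e2, e3, e4, add_zero]
      by_cases hz3 : z ∈ ball z₀ η
      · have e5 : F₁ z = -c := indicator_of_mem hz3 _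
        have h1 := hgain z hz3
        have h2 : c ≤ g * K z := by
          rw [hc, mul_assoc]
          refine mul_le_mul_of_nonneg_left (le_trans ?_ (hK z hz0).1) hg
          refine mul_le_mul_of_nonneg_left ?_ hlam.le
          exact Real.rpow_le_rpow_of_nonpos (norm_pos_iff.2 hz0) (hD z hz3).2.le (by
            have : (0 : ℝ) ≤ d := d.cast_nonneg
            linarith)
        rw [e5]
        calc _ ≤ (M * ‖z‖ ^ 2 - g) * K z := mul_le_mul_of_nonneg_right (by linarith) hKz
          _ ≤ _ := by linarith
      · have e5 : F₁ z = 0 := indicator_of_notMem hz3 _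
        have h1 := hnear z (by simpa using hz1)
        rw [e5, zero_add, ← mul_assoc]
        exact mul_le_mul_of_nonneg_right (by linarith) hKz
    · have e2 : F₂ z = 0 := indicator_of_notMem hz1 _
      have e3 : F₃ z = (|u (x + z) - u x| * K z + |u (y + z) - u y| * K z) +
          ‖q‖ * (‖z‖ * K z) := indicator_of_mem (show z ∈ (ball (0 : E d) (1 / 4))ᶜ from hz1) _
      have e4 : F₁ z = 0 := indicator_of_notMem (fun h => hz1 (by
        rw [mem_ball_zero_iff]; linarith [(hD z h).2])) _
      rw [e2, e3, e4, zero_add, zero_add, ← mul_assoc, ← add_mul, ← add_mul]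
      refine mul_le_mul_of_nonneg_right ?_ hKz
      have h1 := (abs_le.1 (abs_indicator_inner_le q z)).1
      have h2 := le_abs_self (u (x + z) - u x)
      have h3 := neg_abs_le (u (y + z) - u y)
      linarith
  have h1 := setIntegral_mono_on iG ((j1.add j2).add j3).integrableOn measurableSet_ball.compl hpt
  rw [integral_sub' (integrableOn_nonlocal hs hlam hLam hKm hK hu hL (p + q) x hδ)
    (integrableOn_nonlocal hs hlam hLam hKm hK hu hL p y hδ),
    integral_add' (j1.add j2).integrableOn j3.integrableOn,
    integral_add' j1.integrableOn j2.integrableOn, k1] at h1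
  unfold nonlocalEval
  linarith

/-! ### Doubling of variables -/

/-- The point where the penalised difference of `u` attains its maximum. -/
lemma exists_doubling_point {u : E d → ℝ} (hu : Continuous u) {θ : ℝ} (hθ : 0 < θ)
    {R L Z : ℝ} (hZ : 0 < Z) (hO : osc u (ball (0 : E d) (R + 2)) ≤ Z)
    (hL : 6 * Z ≤ L) {x₀ y₀ : E d} (hx₀ : x₀ ∈ ball (0 : E d) R) (hy₀ : ‖x₀ - y₀‖ ≤ 1 / 2)
    (hcon : L * ‖x₀ - y₀‖ < u x₀ - u y₀) :
    ∃ x y : E d, ‖x‖ < R + 1 / 2 ∧ 0 < ‖x - y‖ ∧ ‖x - y‖ < 1 / 4 ∧ ‖x - x₀‖ < 1 / 2 ∧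
      3 / 4 * L * ‖x - y‖ ≤ u x - u y ∧ u x - u y ≤ Z ∧
      (∀ z, ‖z‖ ≤ 1 / 4 → u (x + z) - u x ≤
        L * (profile θ ‖x - y + z‖ - profile θ ‖x - y‖) +
          (inner ℝ z ((8 * Z) • (x - x₀)) + 4 * Z * ‖z‖ ^ 2)) ∧
      (∀ z, ‖z‖ ≤ 1 / 4 → u y - u (y + z) ≤
        L * (profile θ ‖x - y - z‖ - profile θ ‖x - y‖)) ∧
      (∀ z, ‖z‖ ≤ 1 / 4 → u (x + z) - u x - (u (y + z) - u y) ≤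
          inner ℝ z ((8 * Z) • (x - x₀)) + 4 * Z * ‖z‖ ^ 2) := by
  have hL0 : 0 < L := by linarith
  have hx₀R : ‖x₀‖ < R := by simpa using hx₀
  -- The weight `4 * Z` gives the penalty the value `Z`, which dominates the oscillation, at
  -- distance `1/2` from `x₀`. Only `x` is localised, so `y` feels no extra gradient.
  set Φ : E d × E d → ℝ := fun w => u w.1 - u w.2 - L * profile θ ‖w.1 - w.2‖
    - 4 * Z * ‖w.1 - x₀‖ ^ 2 with hΦ
  set S : Set (E d × E d) := {w | ‖w.1 - x₀‖ ≤ 3 / 4 ∧ ‖w.1 - w.2‖ ≤ 1 / 2} with hS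
  have hΦc : Continuous Φ := by
    have h1 : Continuous fun w : E d × E d => profile θ ‖w.1 - w.2‖ := by
      unfold profile
      have : Continuous fun w : E d × E d => ‖w.1 - w.2‖ := by fun_prop
      exact this.sub ((this.rpow_const fun _ => Or.inr (by linarith)).div_const 4)
    fun_prop
  have hSc : IsCompact S := by
    refine ((isCompact_closedBall x₀ 1).prod (isCompact_closedBall x₀ 2)).of_isClosed_subset ?_ ?_
    · exact (isClosed_le (f := fun w : E d × E d => ‖w.1 - x₀‖) (by fun_prop)
        continuous_const).inter (isClosed_le (f := fun w : E d × E d => ‖w.1 - w.2‖)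
        (by fun_prop) continuous_const)
    · rintro ⟨x, y⟩ ⟨h1, h2⟩
      simp only at h1 h2
      refine ⟨?_, ?_⟩
      · rw [mem_closedBall, dist_eq_norm]; linarith
      · rw [mem_closedBall, dist_eq_norm]
        have : y - x₀ = (x - x₀) - (x - y) := by abel
        have := norm_sub_le (x - x₀) (x - y)
        simp only at *
        rw [‹y - x₀ = _›]
        linarith
  have h0S : (x₀, y₀) ∈ S := ⟨by simp; norm_num, hy₀⟩
  obtain ⟨⟨x, y⟩, hxy, hmax⟩ := hSc.exists_isMaxOn ⟨_, h0S⟩ hΦc.continuousOn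
  obtain ⟨h1, h2⟩ : ‖x - x₀‖ ≤ 3 / 4 ∧ ‖x - y‖ ≤ 1 / 2 := hxy
  have h3 : Φ (x₀, y₀) ≤ Φ (x, y) := hmax h0S
  have h4 : 0 < Φ (x₀, y₀) := by
    have := (profile_bounds hθ (norm_nonneg (x₀ - y₀)) (by linarith)).2
    have := mul_le_mul_of_nonneg_left this hL0.le
    simp only [hΦ, sub_self, norm_zero]
    linarith
  have hpos : 0 < u x - u y - L * profile θ ‖x - y‖ - 4 * Z * ‖x - x₀‖ ^ 2 := h4.trans_le h3
  obtain ⟨hw, -⟩ := profile_bounds hθ (norm_nonneg (x - y)) (by linarith)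
  have hw' := mul_le_mul_of_nonneg_left hw hL0.le
  have hxn : ‖x‖ ≤ ‖x - x₀‖ + ‖x₀‖ := by simpa using norm_add_le (x - x₀) x₀
  have hyn : ‖y‖ ≤ ‖x‖ + ‖x - y‖ := by simpa using norm_sub_le x (x - y)
  have hdiff : u x - u y ≤ Z := (sub_le_osc hu (by rw [mem_ball_zero_iff]; linarith)
    (by rw [mem_ball_zero_iff]; linarith)).trans hO
  have hq0 : 0 ≤ 4 * Z * ‖x - x₀‖ ^ 2 := by positivity
  have hw0 : 0 ≤ L * (3 / 4 * ‖x - y‖) := by positivity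
  have hr0 : 0 < ‖x - y‖ := by
    refine (norm_nonneg _).lt_of_ne' fun h => ?_
    have hxy' : u x = u y := by rw [sub_eq_zero.1 (norm_eq_zero.1 h)]
    rw [h, profile_zero hθ] at hpos
    linarith
  -- From `3/4 * L * r < Z` and `L ≥ 6 * Z`. With `‖x - x₀‖ < 1/2` below, this leaves a margin of
  -- `1/4` inside `S` for shifting the maximum point.
  have hr4 : ‖x - y‖ < 1 / 4 := by
    by_contra! hge
    have : L * (3 / 4 * (1 / 4)) ≤ L * (3 / 4 * ‖x - y‖) := by gcongr
    linarith
  have hx2 : ‖x - x₀‖ < 1 / 2 := by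
    by_contra! hge
    have : 4 * Z * (1 / 2) ^ 2 ≤ 4 * Z * ‖x - x₀‖ ^ 2 := by gcongr
    linarith
  have hsq : ∀ z, 4 * Z * ‖x + z - x₀‖ ^ 2 = 4 * Z * ‖x - x₀‖ ^ 2 +
      (inner ℝ z ((8 * Z) • (x - x₀)) + 4 * Z * ‖z‖ ^ 2) := fun z => by
    have : x + z - x₀ = (x - x₀) + z := by abel
    rw [this, norm_add_sq_real, inner_smul_right, real_inner_comm]
    ring
  have hxz : ∀ z, ‖z‖ ≤ 1 / 4 → ‖x + z - x₀‖ ≤ 3 / 4 := fun z hz => by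
    have : x + z - x₀ = (x - x₀) + z := by abel
    rw [this]
    linarith [norm_add_le (x - x₀) z]
  refine ⟨x, y, by linarith, hr0, hr4, hx2, by linarith, hdiff, ?_, ?_, ?_⟩
  · intro z hz
    have e : x + z - y = x - y + z := by abel
    have h5 : Φ (x + z, y) ≤ Φ (x, y) := hmax (show _ ∧ _ from ⟨hxz z hz, by
      change ‖x + z - y‖ ≤ 1 / 2
      rw [e]; linarith [norm_add_le (x - y) z]⟩)
    simp only [hΦ] at h5
    rw [hsq z, e] at h5
    linarith
  · intro z hz
    have e : x - (y + z) = x - y - z := by abel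
    have h5 : Φ (x, y + z) ≤ Φ (x, y) := hmax (show _ ∧ _ from ⟨h1, by
      change ‖x - (y + z)‖ ≤ 1 / 2
      rw [e]; linarith [norm_sub_le (x - y) z]⟩)
    simp only [hΦ] at h5
    rw [e] at h5
    linarith
  -- A common translation of both points leaves `x - y` unchanged, so `L` does not enter.
  · intro z hz
    have e : x + z - (y + z) = x - y := by abel
    have h5 : Φ (x + z, y + z) ≤ Φ (x, y) := hmax (show _ ∧ _ from ⟨hxz z hz, by
      change ‖x + z - (y + z)‖ ≤ 1 / 2
      rw [e]; linarith⟩)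
    simp only [hΦ] at h5
    rw [hsq z, e] at h5
    linarith

/-- Used to pick the viscosity radius so small that the paraboloid part, with a coefficient of order
`L / r`, contributes at most `1`. -/
lemma exists_small_rpow (k : ℝ) {e ρ : ℝ} (he : 0 < e) (hρ : 0 < ρ) :
    ∃ δ : ℝ, 0 < δ ∧ δ ≤ ρ ∧ k * δ ^ e ≤ 1 := by
  have h1 : Filter.Tendsto (fun δ : ℝ => k * δ ^ e) (nhdsWithin 0 (Ioi 0)) (nhds (k * 0 ^ e)) :=
    ((Real.continuous_rpow_const he.le).tendsto 0).const_mul k |>.mono_left nhdsWithin_le_nhds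
  rw [Real.zero_rpow he.ne', mul_zero] at h1
  have h2 : ∀ᶠ δ : ℝ in nhdsWithin 0 (Ioi 0), δ ≤ ρ :=
    nhdsWithin_le_nhds (Iic_mem_nhds hρ)
  obtain ⟨δ, h3, h4, h5⟩ := ((h1.eventually (ge_mem_nhds one_pos)).and
    (h2.and self_mem_nhdsWithin)).exists
  exact ⟨δ, h5, h4, h3⟩

lemma norm_inequalities_near_quarter {a z : E d} {η : ℝ}
    (hz : z ∈ ball ((1 / 4 : ℝ) • a) η) :
    ‖a + z‖ ≤ 5 / 4 * ‖a‖ + η ∧ ‖a - z‖ ≤ 3 / 4 * ‖a‖ + η ∧ 1 / 4 * ‖a‖ - η ≤ ‖z‖ ∧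
      ‖z‖ ≤ 1 / 4 * ‖a‖ + η := by
  set e := z - (1 / 4 : ℝ) • a with he_def
  have he : ‖e‖ < η := by rwa [← dist_eq_norm]
  have hz' : z = (1 / 4 : ℝ) • a + e := by rw [he_def]; abel
  have n : ∀ c : ℝ, 0 ≤ c → ‖c • a‖ = c * ‖a‖ := fun c hc => by
    rw [norm_smul, Real.norm_of_nonneg hc]
  have e1 : a + z = (5 / 4 : ℝ) • a + e := by rw [hz']; module
  have e2 : a - z = (3 / 4 : ℝ) • a - e := by rw [hz']; module
  have h1 := norm_add_le ((5 / 4 : ℝ) • a) e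
  have h2 := norm_sub_le ((3 / 4 : ℝ) • a) e
  have h3 := norm_add_le ((1 / 4 : ℝ) • a) e
  have h4 := norm_sub_le z e
  have e3 : z - e = (1 / 4 : ℝ) • a := by rw [hz']; abel
  rw [← e1, n _ (by norm_num)] at h1
  rw [← e2, n _ (by norm_num)] at h2
  rw [← hz', n _ (by norm_num)] at h3
  rw [e3, n _ (by norm_num)] at h4
  refine ⟨?_, ?_, ?_, ?_⟩ <;> linarith

/-- Near `a / 4` the two norms are close to `5/4 * ‖a‖` and `3/4 * ‖a‖`. The radius is taken so
small that the two errors, each at most that radius because the profile slope is at most one,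
consume only part of the exact second difference. -/
lemma profile_gain {θ : ℝ} (hθ : 0 < θ) (hθ' : θ ≤ 1) {a z : E d} (ha : a ≠ 0)
    (ha' : ‖a‖ ≤ 1 / 4) (hz : z ∈ ball ((1 / 4 : ℝ) • a) (profileGap θ / 32 * ‖a‖ ^ (1 + θ))) :
    profile θ ‖a + z‖ - profile θ ‖a‖ + (profile θ ‖a - z‖ - profile θ ‖a‖) ≤
      -(profileGap θ / 8 * ‖a‖ ^ (1 + θ)) := by
  have hr : 0 < ‖a‖ := norm_pos_iff.2 ha
  have hG := profileGap_pos hθ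
  obtain ⟨h1, h2, -, -⟩ := norm_inequalities_near_quarter hz
  set η := profileGap θ / 32 * ‖a‖ ^ (1 + θ) with hη
  have hη0 : 0 ≤ η := by positivity
  have h3 := profile_le_add hθ hθ' (by positivity : 0 < 5 / 4 * ‖a‖) (by linarith)
    (norm_nonneg _) hη0 h1
  have h4 := profile_le_add hθ hθ' (by positivity : 0 < 3 / 4 * ‖a‖) (by linarith)
    (norm_nonneg _) hη0 h2
  have h5 := profile_second_difference (θ := θ) hr.le
  have h6 : 0 ≤ profileGap θ * ‖a‖ ^ (1 + θ) := by positivity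
  linarith

lemma profile_norm_le_quadratic {θ L : ℝ} (hθ : 0 < θ) (hθ' : θ ≤ 1) (hL : 0 ≤ L) {a : E d}
    (ha : a ≠ 0) (ha' : ‖a‖ ≤ 1) (z : E d) :
    L * (profile θ ‖a + z‖ - profile θ ‖a‖) ≤
      inner ℝ ((L * profileSlope θ ‖a‖ / ‖a‖) • a) z +
        L * profileSlope θ ‖a‖ / (2 * ‖a‖) * ‖z‖ ^ 2 := by
  have hr : 0 < ‖a‖ := norm_pos_iff.2 ha
  have h1 := profile_le_tangent hθ hr (norm_nonneg (a + z))
  have h2 := (profileSlope_bounds hθ hθ' hr.le ha').1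
  have h3 : profileSlope θ ‖a‖ * (‖a + z‖ - ‖a‖) ≤
      profileSlope θ ‖a‖ * ((2 * inner ℝ a z + ‖z‖ ^ 2) / (2 * ‖a‖)) :=
    mul_le_mul_of_nonneg_left (norm_add_sub_norm_le ha z) (by linarith)
  calc L * (profile θ ‖a + z‖ - profile θ ‖a‖)
      ≤ L * (profileSlope θ ‖a‖ * ((2 * inner ℝ a z + ‖z‖ ^ 2) / (2 * ‖a‖))) :=
        mul_le_mul_of_nonneg_left (by linarith) hL
    _ = _ := by
      rw [inner_smul_left]
      simp only [conj_trivial]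
      field_simp

/-- Bound for the Hamiltonian terms produced by doubling the variables. -/
lemma HypH1.doubling_bound {m : ℝ} {CH : ℝ → ℝ} {H : E d → E d → ℝ} (h : HypH1 m CH H)
    (hm : 1 ≤ m) {R : ℝ} (hR : 0 < R) {x y : E d} (hx : x ∈ ball (0 : E d) R)
    (hy : y ∈ ball (0 : E d) R) {p q : E d} {L Z : ℝ} (hL : 1 ≤ L) (hp : ‖p‖ ≤ L)
    (hq : ‖q‖ ≤ 4 * Z) (hZL : 4 * Z ≤ L) (hr : 3 / 4 * L * ‖x - y‖ ≤ Z) :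
    |H x (p + q) - H y p| ≤ (3 + 8 * 2 ^ (m - 1)) * CH R * (Z * L ^ (m - 1)) := by
  refine (h.abs_sub_le hm hR hx hy p q).trans ?_
  have hC := (h R hR).1
  have hL0 : 0 < L := by linarith
  have e1 : L * L ^ (m - 1) = L ^ m := by
    rw [← Real.rpow_one_add' hL0.le (by linarith)]; congr 1; ring
  have h1 : 1 + ‖p‖ ^ m ≤ 2 * L ^ m := by
    have : ‖p‖ ^ m ≤ L ^ m := Real.rpow_le_rpow (norm_nonneg p) hp (by linarith)
    have : 1 ≤ L ^ m := Real.one_le_rpow hL (by linarith)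
    linarith
  have h2 : ‖x - y‖ * (1 + ‖p‖ ^ m) ≤ 3 * (Z * L ^ (m - 1)) := by
    have hP : 0 ≤ L ^ (m - 1) := by positivity
    calc ‖x - y‖ * (1 + ‖p‖ ^ m) ≤ ‖x - y‖ * (2 * L ^ m) := by gcongr
      -- One factor `L` is traded for `Z`, since `L * ‖x - y‖ ≤ 4/3 * Z` at the maximum point.
      _ = (2 * (L * ‖x - y‖)) * L ^ (m - 1) := by rw [← e1]; ring
      _ ≤ (3 * Z) * L ^ (m - 1) := by
          refine mul_le_mul_of_nonneg_right ?_ hP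
          have : 0 ≤ L * ‖x - y‖ := by positivity
          linarith
      _ = _ := by ring
  have h3 : (‖p‖ + ‖q‖) ^ (m - 1) ≤ 2 ^ (m - 1) * L ^ (m - 1) := by
    rw [← Real.mul_rpow (by norm_num) hL0.le]
    exact Real.rpow_le_rpow (by positivity) (by linarith) (by linarith)
  have h4 : ‖q‖ * (‖p‖ + ‖q‖) ^ (m - 1) ≤ 4 * Z * (2 ^ (m - 1) * L ^ (m - 1)) := by
    gcongr
    exact (norm_nonneg q).trans hq
  calc _ ≤ CH R * (3 * (Z * L ^ (m - 1)) + 2 * (4 * Z * (2 ^ (m - 1) * L ^ (m - 1)))) := by gcongr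
    _ = _ := by ring

/-- The inequality obtained by doubling variables when a Lipschitz bound fails. -/
lemma exists_doubling_inequality {s m lam Lam κ θ : ℝ} (hd : 1 ≤ d) (hs : 1 / 2 < s) (hs' : s < 1)
    (hm : 1 ≤ m) (hlam : 0 < lam) (hLam : 0 ≤ Lam) (hθ : 0 < θ) (hθ' : θ ≤ 1) :
    ∃ c C : ℝ, 0 < c ∧ 0 < C ∧ ∀ (K : E d → ℝ) (α : ℝ) (H : E d → E d → ℝ) (CH : ℝ → ℝ)
      (f : E d → ℝ), Admissible d s m lam Lam κ K α H CH f →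
      ∀ (R : ℝ) (u : E d → ℝ), 0 < R → Continuous u → MemL1Weighted d s u →
      IsViscositySolution K α H f u (ball 0 (R + 2)) →
      ∀ Z L : ℝ, zetaTwo s f u R ≤ Z → 6 * Z ≤ L →
      ∀ x₀ y₀ : E d, x₀ ∈ ball (0 : E d) R → ‖x₀ - y₀‖ ≤ 1 / 2 → L * ‖x₀ - y₀‖ < u x₀ - u y₀ →
      ∃ x y : E d, ‖x‖ < R + 1 / 2 ∧ 0 < ‖x - y‖ ∧ ‖x - y‖ < 1 / 4 ∧
        3 / 4 * L * ‖x - y‖ ≤ u x - u y ∧ u x - u y ≤ Z ∧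
        c * (L * ‖x - y‖ ^ (1 - 2 * s + θ * (1 + d))) ≤
          C * ((1 + CH (R + 2)) * (Z * L ^ (m - 1))) := by
  set G := profileGap θ with hG_def
  have hG := profileGap_pos hθ
  have hG1 := profileGap_le_one hθ hθ'
  rw [← hG_def] at hG hG1
  set V : ℝ := volume.real (ball (0 : E d) 1) with hV_def
  have hV : 0 < V := by
    rw [hV_def, measureReal_def]
    exact ENNReal.toReal_pos (measure_ball_pos volume 0 one_pos).ne' measure_ball_lt_top.ne
  have hn := nearConst_nonneg d s
  have hf := farConst_nonneg d s
  set C₁ : ℝ := 2 + 4 * (Lam * nearConst d s * (1 / 4) ^ (2 - 2 * s)) +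
    2 * (Lam * (1 + (1 / 4) ^ (-((d : ℝ) + 2 * s)))) +
    4 * (Lam * farConst d s * (1 / 4) ^ (1 - 2 * s)) with hC₁
  set C₂ : ℝ := 3 + 8 * 2 ^ (m - 1) with hC₂
  have hC₁0 : 0 < C₁ := by positivity
  have hC₂0 : 0 < C₂ := by positivity
  refine ⟨G / 8 * lam * ((G / 32) ^ d * V), C₁ + C₂, by positivity, by positivity, ?_⟩
  intro K α H CH f hAd R u hR hu hL1 hsol Z L hZ hZL x₀ y₀ hx₀ hy₀ hcon
  have hζ := one_le_zetaTwo (s := s) hAd.continuous_f hu hR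
  have hof := osc_nonneg hAd.continuous_f (show 0 < R + 2 by linarith)
  have hou := osc_nonneg hu (show 0 < R + 2 by linarith)
  have htl := tail_nonneg s u (ball 0 (R + 2))
  have hZ' : 1 + osc u (ball 0 (R + 2)) + osc f (ball 0 (R + 2)) +
    tail s u (ball 0 (R + 2)) 1 ≤ Z := hZ
  have hZ1 : 1 ≤ Z := hζ.trans hZ
  have hL0 : 1 ≤ L := by linarith
  obtain ⟨x, y, hxR, hr0, hr4, hxx, hLr, hxyZ, t1, t2, t3⟩ := exists_doubling_point hu hθ
    (by linarith) (by linarith) hZL hx₀ hy₀ hcon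
  refine ⟨x, y, hxR, hr0, hr4, hLr, hxyZ, ?_⟩
  set a := x - y with ha_def
  have ha : a ≠ 0 := norm_pos_iff.1 hr0
  set r := ‖a‖ with hr_def
  set q : E d := (8 * Z) • (x - x₀) with hq_def
  set p : E d := (L * profileSlope θ r / r) • a with hp_def
  have hyR : ‖y‖ ≤ ‖x‖ + r := by simpa [ha_def, hr_def] using norm_sub_le x (x - y)
  have hx : x ∈ ball (0 : E d) (R + 2) := by rw [mem_ball_zero_iff]; linarith
  have hy : y ∈ ball (0 : E d) (R + 2) := by rw [mem_ball_zero_iff]; linarith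
  have hq : ‖q‖ ≤ 4 * Z := by
    rw [hq_def, norm_smul, Real.norm_of_nonneg (by linarith)]
    have := mul_le_mul_of_nonneg_left hxx.le (show 0 ≤ 8 * Z by linarith)
    linarith
  obtain ⟨hw1, hw2⟩ := profileSlope_bounds hθ hθ' hr0.le (by linarith)
  have hp : ‖p‖ ≤ L := by
    rw [hp_def, norm_smul, Real.norm_of_nonneg (by positivity), ← hr_def,
      div_mul_cancel₀ _ hr0.ne']
    exact mul_le_of_le_one_right (by linarith) hw2
  set k : ℝ := L * profileSlope θ r / (2 * r) with hk_def
  have hk : 0 ≤ k := by positivity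
  -- The coefficient sums the two touching paraboloids: `k + 4 * Z` at `x` and `k` at `y`. The
  -- choice of `δ` depends on the maximum point, but the final estimate does not see it.
  obtain ⟨δ, hδ, hδr, hδk⟩ := exists_small_rpow ((k + 4 * Z + k) * (Lam * nearConst d s))
    (show 0 < 2 - 2 * s by linarith) (show 0 < r / 8 by linarith)
  have hsub := hsol.1.touch (p := p + q) (k := k + 4 * Z) hx hδ (by linarith) (fun z hz => by
    have h1 := t1 z (by linarith)
    have h2 := profile_norm_le_quadratic hθ hθ' (by linarith : 0 ≤ L) ha (by linarith) z
    rw [inner_add_left, real_inner_comm z q]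
    linarith)
  have hsup := hsol.2.touch (p := p) (k := -k) hy hδ (by linarith) (fun z hz => by
    have h1 := t2 z (by linarith)
    have h2 := profile_norm_le_quadratic hθ hθ' (by linarith : 0 ≤ L) ha (by linarith) (-z)
    rw [← sub_eq_add_neg, inner_neg_right, norm_neg] at h2
    linarith)
  obtain ⟨-, hI0, hI⟩ := integrableOn_sq_kernel hd hs' hlam hLam hAd.measurable_kernel
    hAd.elliptic hδ
  set I := ∫ z in ball (0 : E d) δ, ‖z‖ ^ 2 * K z with hI_def
  have hkI : (k + 4 * Z + k) * I ≤ 1 := by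
    refine le_trans ?_ hδk
    rw [mul_assoc]
    exact mul_le_mul_of_nonneg_left hI (by linarith)
  have hrθ : r ^ (1 + θ) ≤ r := by
    simpa using Real.rpow_le_rpow_of_exponent_ge hr0 (by linarith) (by linarith : 1 ≤ 1 + θ)
  have hη0 : 0 < G / 32 * r ^ (1 + θ) := by positivity
  have hηr : G / 32 * r ^ (1 + θ) ≤ r / 32 := by
    have := mul_le_mul hG1 hrθ (by positivity) (by norm_num)
    linarith
  have hdiff := nonlocalEval_sub_le hd hs hs' hlam hLam hAd.measurable_kernel hAd.elliptic hu hL1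
    (x := x) (y := y) (p := p) (q := q) (z₀ := (1 / 4 : ℝ) • a) (M := 4 * Z)
    (g := L * (G / 8 * r ^ (1 + θ))) (r := r) (η := G / 32 * r ^ (1 + θ)) (δ := δ)
    (by linarith) (by positivity) hr4.le hη0 hδ
    (fun z hz => by
      obtain ⟨-, -, h3, h4⟩ := norm_inequalities_near_quarter hz
      constructor <;> linarith)
    (fun z hz => t3 z hz.le)
    -- Separate moves of `x` and of `y` add up to the second difference of the profile.
    (fun z hz => by
      obtain ⟨-, -, h3, h4⟩ := norm_inequalities_near_quarter hz
      have h1 := t1 z (by linarith)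
      have h2 := t2 z (by linarith)
      have h5 := mul_le_mul_of_nonneg_left (profile_gain hθ hθ' ha hr4.le hz)
        (by linarith : 0 ≤ L)
      linarith)
  have hTx := integral_tailIntegrand_le_tail (by linarith) hu hL1 hx
  have hTy := integral_tailIntegrand_le_tail (by linarith) hu hL1 hy
  have hH := hAd.hypH1.doubling_bound hm (by linarith : 0 < R + 2) hx hy hL0 hp hq
    (by linarith) (hLr.trans hxyZ)
  rw [← hC₂] at hH
  have hH' := (abs_le.1 hH).1
  have hfxy := sub_le_osc hAd.continuous_f hx hy
  have hαxy : 0 ≤ α * (u x - u y) := mul_nonneg hAd.alpha_nonneg (by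
    refine le_trans ?_ hLr
    positivity)
  -- Size of the gain: height `L * r ^ (1 + θ)`, kernel at least a multiple of `r ^ (-(d + 2 * s))`,
  -- volume of order `r ^ ((1 + θ) * d)`.
  have e1 : L * (G / 8 * r ^ (1 + θ)) * lam * r ^ (-((d : ℝ) + 2 * s)) *
      ((G / 32 * r ^ (1 + θ)) ^ d * V) =
      G / 8 * lam * ((G / 32) ^ d * V) * (L * r ^ (1 - 2 * s + θ * (1 + d))) := by
    have : r ^ (1 - 2 * s + θ * (1 + d)) =
        r ^ (1 + θ) * r ^ (-((d : ℝ) + 2 * s)) * (r ^ (1 + θ)) ^ d := by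
      rw [← Real.rpow_natCast, ← Real.rpow_mul hr0.le, ← Real.rpow_add hr0, ← Real.rpow_add hr0]
      congr 1
      ring
    rw [this, mul_pow]
    ring
  rw [← hV_def, e1] at hdiff
  have hb1 : Lam * (1 + (1 / 4) ^ (-((d : ℝ) + 2 * s))) *
      ((∫ z, tailIntegrand s u x z) + ∫ z, tailIntegrand s u y z) ≤
      Lam * (1 + (1 / 4) ^ (-((d : ℝ) + 2 * s))) * (2 * Z) := by
    gcongr
    linarith
  have hb2 : ‖q‖ * (Lam * farConst d s * (1 / 4) ^ (1 - 2 * s)) ≤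
      4 * Z * (Lam * farConst d s * (1 / 4) ^ (1 - 2 * s)) := by gcongr
  have hmain : G / 8 * lam * ((G / 32) ^ d * V) * (L * r ^ (1 - 2 * s + θ * (1 + d))) ≤
      C₁ * Z + C₂ * CH (R + 2) * (Z * L ^ (m - 1)) := by
    have e2 : C₁ * Z = 2 * Z + 4 * Z * (Lam * nearConst d s * (1 / 4) ^ (2 - 2 * s)) +
      Lam * (1 + (1 / 4) ^ (-((d : ℝ) + 2 * s))) * (2 * Z) +
      4 * Z * (Lam * farConst d s * (1 / 4) ^ (1 - 2 * s)) := by rw [hC₁]; ring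
    rw [e2]
    linarith
  refine hmain.trans ?_
  have hCH := (hAd.hypH1 (R + 2) (by linarith)).1
  have hLm : 1 ≤ L ^ (m - 1) := Real.one_le_rpow hL0 (by linarith)
  have h1 : C₁ * Z ≤ C₁ * (Z * L ^ (m - 1)) :=
    mul_le_mul_of_nonneg_left (le_mul_of_one_le_right (by linarith) hLm) hC₁0.le
  have h2 : 0 ≤ C₂ * (Z * L ^ (m - 1)) := by positivity
  have h3 : 0 ≤ C₁ * CH (R + 2) * (Z * L ^ (m - 1)) := by positivity
  linarith

/-! ### Lipschitz bounds -/

lemma isLipschitzOnBall_of_subsingleton {u : E 0 → ℝ} {R L : ℝ} (hL : 0 < L) :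
    IsLipschitzOnBall u R L :=
  ⟨hL, fun x _ y _ => by rw [Subsingleton.elim x y]; simp⟩

/-- At distance at least `1/2` the oscillation bound already gives the Lipschitz inequality. -/
lemma isLipschitzOnBall_of_forall_near {u : E d → ℝ} (hu : Continuous u) {R L : ℝ} (hL : 0 < L)
    (hO : 2 * osc u (ball (0 : E d) (R + 2)) ≤ L)
    (h : ∀ x ∈ ball (0 : E d) R, ∀ y, ‖x - y‖ ≤ 1 / 2 → u x - u y ≤ L * ‖x - y‖) :
    IsLipschitzOnBall u R L := by
  have key : ∀ x ∈ ball (0 : E d) R, ∀ y ∈ ball (0 : E d) R, u x - u y ≤ L * ‖x - y‖ := by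
    intro x hx y hy
    rcases le_total ‖x - y‖ (1 / 2) with h1 | h1
    · exact h x hx y h1
    · have hsub : ball (0 : E d) R ⊆ ball 0 (R + 2) := ball_subset_ball (by linarith)
      have h2 := sub_le_osc hu (hsub hx) (hsub hy)
      have h3 := mul_le_mul_of_nonneg_left h1 hL.le
      linarith
  refine ⟨hL, fun x hx y hy => abs_le.2 ⟨?_, key x hx y hy⟩⟩
  have := key y hy x hx
  rw [norm_sub_rev] at this
  linarith

/-- Collects the powers of `L` after the separation has been replaced by its upper bound. The
resulting exponent `2 + σ - m` is positive in both applications, so `L` cannot be too large. -/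
lemma rpow_balance {c C L Z b σ m : ℝ} (hL : 0 < L) (hZ : 0 < Z) (hb : 0 < b)
    (h : c * (L * (b * Z / L) ^ (-σ)) ≤ C * (Z * L ^ (m - 1))) :
    c * L ^ (2 + σ - m) ≤ C * b ^ σ * Z ^ (1 + σ) := by
  have e1 : (b * Z / L) ^ (-σ) * (b ^ σ * Z ^ σ) = L ^ σ := by
    rw [← Real.mul_rpow hb.le hZ.le, Real.rpow_neg (by positivity), Real.div_rpow (by positivity)
      hL.le]
    field_simp
  have e2 : L * L ^ σ * L ^ (-(m - 1)) = L ^ (2 + σ - m) := by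
    have h0 : L * L ^ σ = L ^ (1 + σ) := by rw [Real.rpow_add hL, Real.rpow_one]
    rw [h0, ← Real.rpow_add hL]
    congr 1
    ring
  have e3 : L ^ (m - 1) * L ^ (-(m - 1)) = 1 := by
    rw [← Real.rpow_add hL, add_neg_cancel, Real.rpow_zero]
  have e4 : Z * Z ^ σ = Z ^ (1 + σ) := by rw [Real.rpow_add hZ, Real.rpow_one]
  have hF : 0 ≤ b ^ σ * Z ^ σ * L ^ (-(m - 1)) := by positivity
  have h1 := mul_le_mul_of_nonneg_right h hF
  calc c * L ^ (2 + σ - m) = c * (L * (b * Z / L) ^ (-σ)) * (b ^ σ * Z ^ σ * L ^ (-(m - 1))) := by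
        rw [← e2, ← e1]; ring
    _ ≤ C * (Z * L ^ (m - 1)) * (b ^ σ * Z ^ σ * L ^ (-(m - 1))) := h1
    _ = C * b ^ σ * (Z * Z ^ σ) * (L ^ (m - 1) * L ^ (-(m - 1))) := by ring
    _ = _ := by rw [e3, e4, mul_one]

lemma exists_large_rpow {c e : ℝ} (hc : 0 < c) (he : 0 < e) {C : ℝ} (hC : 0 ≤ C) (B : ℝ) :
    ∃ D : ℝ, 0 < D ∧ B ≤ D ∧ C < c * D ^ e := by
  refine ⟨max B ((C / c + 1) ^ (1 / e)), lt_max_of_lt_right (by positivity), le_max_left _ _, ?_⟩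
  have h1 : C / c + 1 ≤ (max B ((C / c + 1) ^ (1 / e))) ^ e := by
    calc C / c + 1 = ((C / c + 1) ^ (1 / e)) ^ e := by
          rw [← Real.rpow_mul (by positivity), one_div_mul_cancel he.ne', Real.rpow_one]
      _ ≤ _ := Real.rpow_le_rpow (by positivity) (le_max_right _ _) he.le
  have h2 := mul_le_mul_of_nonneg_left h1 hc.le
  have h3 : c * (C / c + 1) = C + c := by field_simp
  linarith

lemma bound_rpow {D X Z e a : ℝ} (hD : 0 ≤ D) (hX : 0 ≤ X) (hZ : 0 ≤ Z) (he : e ≠ 0) :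
    (D * X ^ (1 / e) * Z ^ (a / e)) ^ e = D ^ e * X * Z ^ a := by
  rw [Real.mul_rpow (by positivity) (by positivity), Real.mul_rpow hD (by positivity),
    ← Real.rpow_mul hX, ← Real.rpow_mul hZ, one_div_mul_cancel he, div_mul_cancel₀ _ he,
    Real.rpow_one]

lemma exists_lipschitz_const_of_lt {s m lam Lam κ θ₀ : ℝ} (hd : 1 ≤ d) (hs : 1 / 2 < s)
    (hs' : s < 1) (hm : 1 ≤ m) (hlam : 0 < lam) (hLam : 0 ≤ Lam) (hθ : 0 < θ₀)
    (hθ₁ : θ₀ < 2 * s - 1) (hθ₂ : θ₀ < 2 * s + 1 - m) :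
    ∃ C : ℝ, 0 < C ∧ ∀ (K : E d → ℝ) (α : ℝ) (H : E d → E d → ℝ) (CH : ℝ → ℝ) (f : E d → ℝ),
      Admissible d s m lam Lam κ K α H CH f → ∀ (R : ℝ) (u : E d → ℝ), 0 < R → Continuous u →
      MemL1Weighted d s u → IsViscositySolution K α H f u (ball 0 (R + 2)) →
      IsLipschitzOnBall u R (C * (max 1 (CH (R + 2))) ^ (1 / (2 * s + 1 - m - θ₀)) *
        zetaTwo s f u R ^ ((2 * s - θ₀) / (2 * s + 1 - m - θ₀))) := by
  have hd1 : (0 : ℝ) < 1 + d := by positivity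
  -- Dividing by `1 + d` makes the total exponent loss in the gain equal to `θ₀`.
  obtain ⟨c, C, hc, hC, hdbl⟩ := exists_doubling_inequality (κ := κ) (θ := θ₀ / (1 + d)) hd hs hs'
    hm hlam hLam (by positivity) ((div_le_one hd1).2 (by
      have : (0 : ℝ) ≤ d := d.cast_nonneg
      linarith))
  rw [div_mul_cancel₀ _ hd1.ne'] at hdbl
  set e : ℝ := 2 * s + 1 - m - θ₀ with he_def
  have he : 0 < e := by linarith
  set σ : ℝ := 2 * s - 1 - θ₀ with hσ
  -- The factor `2 * C` comes from `1 + CH ≤ 2 * X`, the factor `2 ^ σ` from `r ≤ 2 * Z / L`, and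
  -- `6` from the doubling requirement `6 * Z ≤ L`.
  obtain ⟨D, hD, hD6, hDe⟩ := exists_large_rpow hc he
    (show 0 ≤ 2 * C * 2 ^ σ by positivity) 6
  refine ⟨D, hD, ?_⟩
  intro K α H CH f hAd R u hR hu hL1 hsol
  set Z := zetaTwo s f u R with hZ
  set X := max 1 (CH (R + 2)) with hX
  have hX1 : 1 ≤ X := le_max_left _ _
  have hXC : CH (R + 2) ≤ X := le_max_right _ _
  have hZ1 : 1 ≤ Z := one_le_zetaTwo hAd.continuous_f hu hR
  set L := D * X ^ (1 / e) * Z ^ ((2 * s - θ₀) / e) with hL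
  have hL0 : 0 < L := by positivity
  have hL6 : 6 * Z ≤ L := by
    have h1 : 6 ≤ D * X ^ (1 / e) :=
      hD6.trans (le_mul_of_one_le_right hD.le (Real.one_le_rpow hX1 (by positivity)))
    have h2 : Z ≤ Z ^ ((2 * s - θ₀) / e) := by
      simpa using Real.rpow_le_rpow_of_exponent_le hZ1
        (show 1 ≤ (2 * s - θ₀) / e from (one_le_div he).2 (by linarith))
    exact mul_le_mul h1 h2 (by linarith) (by positivity)
  have hO : osc u (ball (0 : E d) (R + 2)) ≤ Z := by
    have := osc_nonneg hAd.continuous_f (show 0 < R + 2 by linarith)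
    have := tail_nonneg s u (ball 0 (R + 2))
    rw [hZ, zetaTwo]
    linarith
  refine isLipschitzOnBall_of_forall_near hu hL0 (by linarith) fun x₀ hx₀ y₀ hy₀ => ?_
  by_contra! hcon
  obtain ⟨x, y, -, hr0, -, hLr, hxyZ, hineq⟩ := hdbl K α H CH f hAd R u hR hu hL1 hsol Z L le_rfl
    hL6 x₀ y₀ hx₀ hy₀ hcon
  set r := ‖x - y‖
  have h1 : r ≤ 2 * Z / L := by
    rw [le_div_iff₀ hL0]
    linarith
  have h2 : (2 * Z / L) ^ (-σ) ≤ r ^ (1 - 2 * s + θ₀) := by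
    rw [show 1 - 2 * s + θ₀ = -σ by rw [hσ]; ring]
    exact Real.rpow_le_rpow_of_nonpos hr0 h1 (by linarith)
  have hP : 0 ≤ Z * L ^ (m - 1) := by positivity
  have h3 : c * (L * (2 * Z / L) ^ (-σ)) ≤ 2 * C * X * (Z * L ^ (m - 1)) := by
    calc c * (L * (2 * Z / L) ^ (-σ)) ≤ c * (L * r ^ (1 - 2 * s + θ₀)) := by gcongr
      _ ≤ _ := hineq
      _ ≤ C * ((2 * X) * (Z * L ^ (m - 1))) := by gcongr; linarith
      _ = _ := by ring
  have h4 := rpow_balance hL0 (by linarith) two_pos h3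
  rw [show 2 + σ - m = e by rw [hσ, he_def]; ring, show 1 + σ = 2 * s - θ₀ by rw [hσ]; ring, hL,
    bound_rpow hD.le (by linarith) (by linarith) he.ne'] at h4
  have h5 : 0 < X * Z ^ (2 * s - θ₀) := by positivity
  have h6 := mul_lt_mul_of_pos_right hDe h5
  linarith

lemma exists_lipschitz_const_of_le {s m lam Lam κ θ₀ : ℝ} (hd : 1 ≤ d) (hs : 1 / 2 < s)
    (hs' : s < 1) (hm : 2 * s + 1 ≤ m) (hlam : 0 < lam) (hLam : 0 ≤ Lam) (hκ : 0 < κ)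
    (hθ : 0 < θ₀) (hθ₁ : θ₀ < 1) :
    ∃ C : ℝ, 0 < C ∧ ∀ (K : E d → ℝ) (α : ℝ) (H : E d → E d → ℝ) (CH : ℝ → ℝ) (f : E d → ℝ),
      Admissible d s m lam Lam κ K α H CH f → ∀ (R : ℝ) (u : E d → ℝ), 0 < R → Continuous u →
      MemL1Weighted d s u → IsViscositySolution K α H f u (ball 0 (R + 2)) →
      IsLipschitzOnBall u R (C * CH (R + 2) ^ (1 / (1 - θ₀)) *
        max (zetaOne s m α f u R (max 1 R)) (zetaTwo s f u R) ^ ((m - θ₀) / (1 - θ₀))) := by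
  have hd1 : (0 : ℝ) < 1 + d := by positivity
  have hm1 : 0 < m - 1 := by linarith
  -- Rescaled so that `1 - 2 * s + ϑ = -(1 - γ) * σ` with `σ = m - 1 - θ₀`; the Hölder bound
  -- controls `r ^ (1 - γ)` rather than `r`.
  set ϑ : ℝ := θ₀ * (2 * s - 1) / (m - 1) with hϑ
  have hs1 : 0 < 2 * s - 1 := by linarith
  have hϑ0 : 0 < ϑ := by positivity
  have hϑ1 : ϑ ≤ 2 * s - 1 := by
    rw [hϑ, div_le_iff₀ hm1, mul_comm]
    exact mul_le_mul_of_nonneg_left (by linarith) hs1.le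
  obtain ⟨c, C, hc, hC, hdbl⟩ := exists_doubling_inequality (κ := κ) (θ := ϑ / (1 + d)) hd hs hs'
    (by linarith : 1 ≤ m) hlam hLam (by positivity) ((div_le_one hd1).2 (by
      have : (0 : ℝ) ≤ d := d.cast_nonneg
      linarith))
  rw [div_mul_cancel₀ _ hd1.ne'] at hdbl
  obtain ⟨B, hB1, hB⟩ := exists_holder_const hd hs hs' hm hlam hLam hκ
  obtain ⟨hγ0, hγ1⟩ := gammaZero_mem hs hm
  have hγe := one_sub_gammaZero hs hm
  set γ := gammaZero s m with hγ
  set e : ℝ := 1 - θ₀ with he_def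
  have he : 0 < e := by linarith
  set σ : ℝ := m - 1 - θ₀ with hσ
  -- A lower bound for `CH (R + 2) ^ (1 / e)`, so that `D ≥ 6 / μ` ensures `6 * Z ≤ L`.
  set μ : ℝ := (1 / (2 * κ)) ^ (1 / e) with hμ
  have hμ0 : 0 < μ := by positivity
  obtain ⟨D, hD, hD6, hDe⟩ := exists_large_rpow hc he
    (show 0 ≤ C * (1 + 2 * κ) * (2 * B) ^ σ by positivity) (6 / μ)
  refine ⟨D, hD, ?_⟩
  intro K α H CH f hAd R u hR hu hL1 hsol
  set X := CH (R + 2) with hX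
  have hX0 : 1 / (2 * κ) ≤ X :=
    hAd.hypH1.lower_bound hd (by linarith) hκ (hAd.hypH2 hm) (by linarith)
  have hXpos : 0 < X := lt_of_lt_of_le (by positivity) hX0
  set Z := max (zetaOne s m α f u R (max 1 R)) (zetaTwo s f u R) with hZ
  have hZ2 : zetaTwo s f u R ≤ Z := le_max_right _ _
  have hZ1 : 1 ≤ Z := (one_le_zetaTwo hAd.continuous_f hu hR).trans hZ2
  have hou := osc_nonneg hu (show 0 < R + 2 by linarith)
  have hA1 : 1 ≤ constA s α f u R := (constA_bounds (s := s) hAd.alpha_nonneg hAd.continuous_f hu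
    (mem_ball_self (by linarith : 0 < R + 2))).1
  -- The radius factor is at least one because `ρ = max 1 R`; this is the only place where its size
  -- matters.
  have hAZ : constA s α f u R ^ (1 / m) + osc u (ball (0 : E d) (R + 2)) ≤ Z := by
    refine le_trans ?_ (le_max_left _ _)
    unfold zetaOne
    refine le_mul_of_one_le_left (by positivity) (Real.one_le_rpow (le_max_left _ _) ?_)
    linarith
  set L := D * X ^ (1 / e) * Z ^ ((m - θ₀) / e) with hL
  have hL0 : 0 < L := by positivity
  have hL6 : 6 * Z ≤ L := by
    have h1 : 6 ≤ D * X ^ (1 / e) := by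
      rw [div_le_iff₀ hμ0] at hD6
      refine hD6.trans (mul_le_mul_of_nonneg_left ?_ hD.le)
      exact Real.rpow_le_rpow (by positivity) hX0 (by positivity)
    have h2 : Z ≤ Z ^ ((m - θ₀) / e) := by
      simpa using Real.rpow_le_rpow_of_exponent_le hZ1
        (show 1 ≤ (m - θ₀) / e from (one_le_div he).2 (by linarith))
    exact mul_le_mul h1 h2 (by linarith) (by positivity)
  have hO : osc u (ball (0 : E d) (R + 2)) ≤ Z := by
    have : 0 ≤ constA s α f u R ^ (1 / m) := by positivity
    linarith
  refine isLipschitzOnBall_of_forall_near hu hL0 (by linarith) fun x₀ hx₀ y₀ hy₀ => ?_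
  by_contra! hcon
  obtain ⟨x, y, hxR, hr0, hr4, hLr, -, hineq⟩ := hdbl K α H CH f hAd R u hR hu hL1 hsol Z L hZ2
    hL6 x₀ y₀ hx₀ hy₀ hcon
  have hyR : ‖y‖ ≤ ‖x‖ + ‖x - y‖ := by simpa using norm_sub_le x (x - y)
  have hhol := hB K α H CH f hAd R u hR hu hL1 hsol.1 y (by rw [mem_ball_zero_iff]; linarith) x
    (by linarith)
  set r := ‖x - y‖
  -- Combine `3/4 * L * r ≤ u x - u y` with the Hölder bound centred at `y`, then divide by `r ^ γ`.
  have h1 : r ^ (1 - γ) ≤ 2 * B * Z / L := by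
    have hrγ : 0 < r ^ γ := by positivity
    have h2 : r ^ (1 - γ) * r ^ γ = r := by
      rw [← Real.rpow_add hr0, sub_add_cancel, Real.rpow_one]
    have h3 : B * (constA s α f u R ^ (1 / m) + osc u (ball (0 : E d) (R + 2))) * r ^ γ ≤
        B * Z * r ^ γ := by gcongr
    rw [le_div_iff₀ hL0]
    refine le_of_mul_le_mul_right ?_ hrγ
    have h4 : r ^ (1 - γ) * L * r ^ γ = L * r := by
      rw [mul_right_comm, h2, mul_comm]
    have h5 : 0 ≤ B * Z * r ^ γ := by positivity
    rw [h4]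
    linarith
  have h2 : (2 * B * Z / L) ^ (-σ) ≤ r ^ (1 - 2 * s + ϑ) := by
    have hexp : (1 - γ) * -σ = 1 - 2 * s + ϑ := by
      rw [hγe, hσ, hϑ]
      field_simp
      ring
    rw [← hexp, Real.rpow_mul hr0.le]
    exact Real.rpow_le_rpow_of_nonpos (by positivity) h1 (by linarith)
  have hP : 0 ≤ Z * L ^ (m - 1) := by positivity
  have h3 : c * (L * (2 * B * Z / L) ^ (-σ)) ≤ C * (1 + 2 * κ) * X * (Z * L ^ (m - 1)) := by
    have h1X : 1 + X ≤ (1 + 2 * κ) * X := by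
      rw [div_le_iff₀ (by positivity)] at hX0
      linarith
    calc c * (L * (2 * B * Z / L) ^ (-σ)) ≤ c * (L * r ^ (1 - 2 * s + ϑ)) := by gcongr
      _ ≤ _ := hineq
      _ ≤ C * ((1 + 2 * κ) * X * (Z * L ^ (m - 1))) := by gcongr
      _ = _ := by ring
  have h4 := rpow_balance hL0 (by linarith) (by positivity) h3
  rw [show 2 + σ - m = e by rw [hσ, he_def]; ring, show 1 + σ = m - θ₀ by rw [hσ]; ring, hL,
    bound_rpow hD.le hXpos.le (by linarith) he.ne'] at h4
  have h5 : 0 < X * Z ^ (m - θ₀) := by positivity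
  have h6 := mul_lt_mul_of_pos_right hDe h5
  linarith

/-! ### Bounding `constA` by `zetaTwo` on small balls -/

lemma neg_le_nonlocalEval {s lam Lam : ℝ} {K : E d → ℝ} {u : E d → ℝ}
    (hs : 1 / 2 < s) (hlam : 0 < lam) (hLam : 0 ≤ Lam) (hKm : AEMeasurable K volume)
    (hK : IsElliptic d s lam Lam K) (hu : Continuous u) (hL : MemL1Weighted d s u) (p x : E d)
    {ρ : ℝ} (hρ : 0 < ρ) :
    -(Lam * (1 + ρ ^ (-((d : ℝ) + 2 * s))) * (∫ z, tailIntegrand s u x z) +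
      ‖p‖ * (Lam * farConst d s * ρ ^ (1 - 2 * s))) ≤ nonlocalEval K (ball 0 ρ)ᶜ u p x := by
  obtain ⟨i1, b1⟩ := integrableOn_tail_kernel (by linarith) hlam hLam hKm hK hu hL x hρ
  obtain ⟨i2, b2⟩ := integrableOn_norm_kernel hs hlam hLam hKm hK hρ
  have h1 := setIntegral_mono_on (i1.add (i2.const_mul ‖p‖)).neg
    (integrableOn_nonlocal hs hlam hLam hKm hK hu hL p x hρ) measurableSet_ball.compl
    (fun z hz => by
      rw [mem_compl_iff, mem_ball_zero_iff, not_lt] at hz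
      have hKz := hK.nonneg hlam (norm_pos_iff.1 (hρ.trans_le hz))
      have h1 := (abs_le.1 (abs_indicator_inner_le p z)).2
      have h2 := neg_abs_le (u (x + z) - u x)
      simp only [Pi.neg_apply, Pi.add_apply]
      rw [← mul_assoc, ← add_mul, ← neg_mul]
      exact mul_le_mul_of_nonneg_right (by linarith) hKz)
  rw [integral_neg', integral_add' i1 (i2.const_mul ‖p‖), integral_const_mul] at h1
  have h2 := mul_le_mul_of_nonneg_left b2 (norm_nonneg p)
  unfold nonlocalEval
  linarith

lemma HypH1.exists_growth_bound {m : ℝ} {CH : ℝ → ℝ} {H : E d → E d → ℝ} (h : HypH1 m CH H)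
    (hm : 1 ≤ m) (hc : Continuous fun z : E d × E d => H z.1 z.2) {R : ℝ} (hR : 0 < R) :
    ∃ C : ℝ, 0 ≤ C ∧ ∀ x ∈ ball (0 : E d) R, ∀ p : E d, H x p ≤ C * (1 + ‖p‖ ^ m) := by
  have hc0 : Continuous fun x : E d => H x 0 := hc.comp (by fun_prop : Continuous fun x : E d =>
    ((x, 0) : E d × E d))
  obtain ⟨S, hS⟩ := bddAbove_image_ball hc0.abs 0 R
  have hS0 : 0 ≤ S := (abs_nonneg (H 0 0)).trans
    (hS (mem_image_of_mem (fun x : E d => |H x 0|) (mem_ball_self hR)))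
  have hCH := (h R hR).1
  refine ⟨S + 2 * CH R, by positivity, fun x hx p => ?_⟩
  have h1 := (le_abs_self _).trans (h.abs_sub_le_gradient hm hR hx 0 p)
  have h2 : ‖p‖ * ‖p‖ ^ (m - 1) = ‖p‖ ^ m := by
    rw [← Real.rpow_one_add' (norm_nonneg p) (by linarith)]; congr 1; ring
  rw [zero_add, norm_zero, zero_add, h2] at h1
  have h3 : H x 0 ≤ S := (le_abs_self _).trans (hS (mem_image_of_mem (fun x : E d => |H x 0|) hx))
  have h4 : 0 ≤ S * ‖p‖ ^ m := by positivity
  linarith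

/-- A point near the origin at which `u` is touched from below by a paraboloid. -/
lemma exists_paraboloid_touching_below {u : E d → ℝ} (hu : Continuous u) {R Z : ℝ} (hR : 0 < R)
    (hZ : 0 < Z) (hO : osc u (ball (0 : E d) (R + 2)) ≤ Z) :
    ∃ x : E d, ‖x‖ ≤ 1 / 2 ∧
      ∀ z, ‖z‖ < 1 / 2 → inner ℝ ((-16 * Z) • x) z + -(8 * Z) * ‖z‖ ^ 2 ≤ u (x + z) - u x := by
  obtain ⟨x, hx, hmin⟩ := (isCompact_closedBall (0 : E d) 1).exists_isMinOn ⟨0, by simp⟩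
    (f := fun y => u y + 8 * Z * ‖y‖ ^ 2) (by fun_prop)
  have hx1 : ‖x‖ ≤ 1 := by simpa using hx
  have h1 : u x + 8 * Z * ‖x‖ ^ 2 ≤ u 0 + 8 * Z * ‖(0 : E d)‖ ^ 2 := hmin (by simp)
  have h2 : u 0 - u x ≤ Z := (sub_le_osc hu (mem_ball_self (by linarith))
    (by rw [mem_ball_zero_iff]; linarith)).trans hO
  rw [norm_zero] at h1
  have hx2 : ‖x‖ ≤ 1 / 2 := by
    by_contra! h
    have : 8 * Z * (1 / 2) ^ 2 ≤ 8 * Z * ‖x‖ ^ 2 := by gcongr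
    linarith
  refine ⟨x, hx2, fun z hz => ?_⟩
  have h3 : u x + 8 * Z * ‖x‖ ^ 2 ≤ u (x + z) + 8 * Z * ‖x + z‖ ^ 2 := hmin (by
    rw [mem_closedBall_zero_iff]; linarith [norm_add_le x z])
  rw [norm_add_sq_real] at h3
  rw [inner_smul_left]
  simp only [conj_trivial]
  linarith

/-- The only part of `constA` not bounded at once by the data and `zetaTwo` is `-α * inf u⁻`. The
supersolution inequality at a point touched from below by a paraboloid of size `Z` bounds `-α * u`
there by a multiple of `Z ^ m`, through the growth of `H`; the oscillation carries this bound over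
the ball. -/
lemma exists_constA_le {s m lam Lam κ : ℝ} (hd : 1 ≤ d) (hs : 1 / 2 < s) (hs' : s < 1)
    (hm : 1 ≤ m) (hlam : 0 < lam) (hLam : 0 ≤ Lam) {K : E d → ℝ} {α : ℝ} {H : E d → E d → ℝ}
    {CH : ℝ → ℝ} {f : E d → ℝ} (hAd : Admissible d s m lam Lam κ K α H CH f) :
    ∃ C : ℝ, 1 ≤ C ∧ ∀ (R : ℝ) (u : E d → ℝ), 0 < R → R ≤ 1 → Continuous u →
      MemL1Weighted d s u → IsViscositySupersolution K α H f u (ball 0 (R + 2)) →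
      constA s α f u R ≤ C * zetaTwo s f u R ^ m := by
  -- Radius `3` contains every ball of radius `R + 2` with `R ≤ 1`, so the constants are uniform in
  -- `R`.
  obtain ⟨C₁, hC₁, hgrow⟩ := hAd.hypH1.exists_growth_bound hm hAd.continuous_H three_pos
  obtain ⟨F, hF⟩ := bddAbove_image_ball hAd.continuous_f.abs 0 3
  have hF' : ∀ x ∈ ball (0 : E d) 3, |f x| ≤ F := fun x hx =>
    hF (mem_image_of_mem (fun x => |f x|) hx)
  have hF0 : 0 ≤ F := (abs_nonneg _).trans (hF' 0 (mem_ball_self three_pos))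
  have hα := hAd.alpha_nonneg
  have hn := nearConst_nonneg d s
  have hfc := farConst_nonneg d s
  set C₂ : ℝ := 8 * (Lam * nearConst d s * (1 / 2) ^ (2 - 2 * s)) +
    Lam * (1 + (1 / 2) ^ (-((d : ℝ) + 2 * s))) +
    8 * (Lam * farConst d s * (1 / 2) ^ (1 - 2 * s)) with hC₂
  have hC₂0 : 0 ≤ C₂ := by positivity
  set C₃ : ℝ := C₂ + C₁ * (1 + 8 ^ m) + F with hC₃
  have hC₃0 : 0 ≤ C₃ := by positivity
  refine ⟨2 + F + α + C₃, by linarith, fun R u hR hR1 hu hL1 hsup => ?_⟩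
  set Z := zetaTwo s f u R with hZ
  have hZ1 : 1 ≤ Z := one_le_zetaTwo hAd.continuous_f hu hR
  have hof := osc_nonneg hAd.continuous_f (show 0 < R + 2 by linarith)
  have hou := osc_nonneg hu (show 0 < R + 2 by linarith)
  have htl := tail_nonneg s u (ball 0 (R + 2))
  have hO : osc u (ball (0 : E d) (R + 2)) ≤ Z := by rw [hZ, zetaTwo]; linarith
  have hT : tail s u (ball (0 : E d) (R + 2)) 1 ≤ Z := by rw [hZ, zetaTwo]; linarith
  have hZm : Z ≤ Z ^ m := by simpa using Real.rpow_le_rpow_of_exponent_le hZ1 hm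
  have hsub3 : ball (0 : E d) (R + 2) ⊆ ball 0 3 := ball_subset_ball (by linarith)
  obtain ⟨x, hx, htouch⟩ := exists_paraboloid_touching_below hu hR (by linarith) hO
  have hxR : x ∈ ball (0 : E d) (R + 2) := by rw [mem_ball_zero_iff]; linarith
  have h1 := hsup.touch hxR (by norm_num : (0 : ℝ) < 1 / 2) (by norm_num) htouch
  set p : E d := (-16 * Z) • x with hp_def
  have hp : ‖p‖ ≤ 8 * Z := by
    rw [hp_def, norm_smul, Real.norm_eq_abs, abs_of_nonpos (by linarith)]
    have := mul_le_mul_of_nonneg_left hx (show 0 ≤ 16 * Z by linarith)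
    linarith
  have h2 := neg_le_nonlocalEval hs hlam hLam hAd.measurable_kernel hAd.elliptic hu hL1 p x
    (by norm_num : (0 : ℝ) < 1 / 2)
  obtain ⟨-, hI0, hI⟩ := integrableOn_sq_kernel hd hs' hlam hLam hAd.measurable_kernel
    hAd.elliptic (by norm_num : (0 : ℝ) < 1 / 2)
  have hTx := (integral_tailIntegrand_le_tail (by linarith) hu hL1 hxR).trans hT
  have b1 : 8 * Z * (∫ z in ball (0 : E d) (1 / 2), ‖z‖ ^ 2 * K z) ≤
      8 * Z * (Lam * nearConst d s * (1 / 2) ^ (2 - 2 * s)) := by gcongr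
  have b2 : Lam * (1 + (1 / 2) ^ (-((d : ℝ) + 2 * s))) * (∫ z, tailIntegrand s u x z) ≤
      Lam * (1 + (1 / 2) ^ (-((d : ℝ) + 2 * s))) * Z := by gcongr
  have b3 : ‖p‖ * (Lam * farConst d s * (1 / 2) ^ (1 - 2 * s)) ≤
      8 * Z * (Lam * farConst d s * (1 / 2) ^ (1 - 2 * s)) := by gcongr
  have b4 : H x p ≤ C₁ * (1 + 8 ^ m) * Z ^ m := by
    have h3 : ‖p‖ ^ m ≤ 8 ^ m * Z ^ m := by
      rw [← Real.mul_rpow (by norm_num) (by linarith)]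
      exact Real.rpow_le_rpow (norm_nonneg p) hp (by linarith)
    calc H x p ≤ C₁ * (1 + ‖p‖ ^ m) := hgrow x (hsub3 hxR) p
      _ ≤ C₁ * (Z ^ m + 8 ^ m * Z ^ m) := by gcongr; linarith
      _ = _ := by ring
  have hux : -(α * u x) ≤ C₃ * Z ^ m := by
    have e : C₂ * Z = 8 * Z * (Lam * nearConst d s * (1 / 2) ^ (2 - 2 * s)) +
      Lam * (1 + (1 / 2) ^ (-((d : ℝ) + 2 * s))) * Z +
      8 * Z * (Lam * farConst d s * (1 / 2) ^ (1 - 2 * s)) := by rw [hC₂]; ring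
    have h3 : C₂ * Z ≤ C₂ * Z ^ m := by gcongr
    have h4 : F * 1 ≤ F * Z ^ m := by gcongr; linarith
    have h5 := neg_abs_le (f x)
    have h6 := hF' x (hsub3 hxR)
    rw [hC₃]
    linarith
  have hsup' : sSup ((fun x => max (f x) 0) '' ball (0 : E d) (R + 2)) ≤ F := by
    refine csSup_le ⟨_, mem_image_of_mem _ hxR⟩ ?_
    rintro _ ⟨y, hy, rfl⟩
    exact max_le ((le_abs_self _).trans (hF' y (hsub3 hy))) hF0
  have hinf : min (u x) 0 - osc u (ball (0 : E d) (R + 2)) ≤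
      sInf ((fun x => min (u x) 0) '' ball (0 : E d) (R + 2)) := by
    refine le_csInf ⟨_, mem_image_of_mem _ hxR⟩ ?_
    rintro _ ⟨y, hy, rfl⟩
    have h3 := sub_le_osc hu hxR hy
    refine le_min ?_ ?_
    · linarith [min_le_left (u x) 0]
    · linarith [min_le_right (u x) 0]
  have hZm0 : 0 ≤ C₃ * Z ^ m := by positivity
  have hmin : -(α * min (u x) 0) ≤ C₃ * Z ^ m := by
    rcases min_cases (u x) 0 with ⟨h3, -⟩ | ⟨h3, -⟩ <;> rw [h3]
    · exact hux
    · simpa using hZm0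
  have h3 := mul_le_mul_of_nonneg_left hinf hα
  have h4 : α * osc u (ball (0 : E d) (R + 2)) ≤ α * Z ^ m := by gcongr; linarith
  have h5 : F * 1 ≤ F * Z ^ m := by gcongr; linarith
  rw [constA]
  linarith

lemma exists_lipschitz_const_of_le_unscaled {s m lam Lam κ θ₀ : ℝ} (hd : 1 ≤ d) (hs : 1 / 2 < s)
    (hs' : s < 1) (hm : 2 * s + 1 ≤ m) (hlam : 0 < lam) (hLam : 0 ≤ Lam) (hκ : 0 < κ)
    (hθ : 0 < θ₀) (hθ₁ : θ₀ < 1) {K : E d → ℝ} {α : ℝ} {H : E d → E d → ℝ}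
    {CH : ℝ → ℝ} {f : E d → ℝ} (hAd : Admissible d s m lam Lam κ K α H CH f) :
    ∃ C : ℝ, 0 < C ∧ ∀ (R : ℝ) (u : E d → ℝ), 0 < R → Continuous u →
      MemL1Weighted d s u → IsViscositySolution K α H f u (ball 0 (R + 2)) →
      IsLipschitzOnBall u R (C * CH (R + 2) ^ (1 / (1 - θ₀)) *
        max (zetaOne s m α f u R R) (zetaTwo s f u R) ^ ((m - θ₀) / (1 - θ₀))) := by
  obtain ⟨C, hC, hlip⟩ := exists_lipschitz_const_of_le hd hs hs' hm hlam hLam hκ hθ hθ₁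
  obtain ⟨C₁, hC₁, hA⟩ := exists_constA_le hd hs hs' (by linarith : 1 ≤ m) hlam hLam hAd
  set Q : ℝ := C₁ ^ (1 / m) + 1 with hQ
  have hQ1 : 1 ≤ Q := by
    have : 0 ≤ C₁ ^ (1 / m) := by positivity
    linarith
  set e : ℝ := (m - θ₀) / (1 - θ₀) with he
  have he0 : 0 ≤ e := div_nonneg (by linarith) (by linarith)
  refine ⟨C * Q ^ e, by positivity, fun R u hR hu hL1 hsol => ?_⟩
  obtain ⟨hL0, hL⟩ := hlip K α H CH f hAd R u hR hu hL1 hsol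
  have hCH := (hAd.hypH1 (R + 2) (by linarith)).1
  set Z := zetaTwo s f u R with hZ
  have hZ1 : 1 ≤ Z := one_le_zetaTwo hAd.continuous_f hu hR
  set M := max (zetaOne s m α f u R R) Z with hM
  have hMZ : Z ≤ M := le_max_right _ _
  -- For `R ≥ 1` the two radius factors coincide; for `R ≤ 1` the scaled quantity is at most a
  -- multiple of `zetaTwo`, so the vanishing factor `R ^ (1 - γ₀)` does no harm.
  have hle : max (zetaOne s m α f u R (max 1 R)) Z ≤ Q * M := by
    rcases le_total 1 R with h1 | h1
    · rw [max_eq_right h1]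
      exact le_mul_of_one_le_left (by linarith) hQ1
    · rw [max_eq_left h1]
      have hm0 : m ≠ 0 := by linarith
      have hou := osc_nonneg hu (show 0 < R + 2 by linarith)
      have hof := osc_nonneg hAd.continuous_f (show 0 < R + 2 by linarith)
      have htl := tail_nonneg s u (ball 0 (R + 2))
      have hA1 : 1 ≤ constA s α f u R := (constA_bounds (s := s) hAd.alpha_nonneg
        hAd.continuous_f hu (mem_ball_self (by linarith : 0 < R + 2))).1
      have h2 : constA s α f u R ^ (1 / m) ≤ C₁ ^ (1 / m) * Z := by
        calc constA s α f u R ^ (1 / m) ≤ (C₁ * Z ^ m) ^ (1 / m) :=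
              Real.rpow_le_rpow (by linarith) (hA R u hR h1 hu hL1 hsol.2)
                (one_div_nonneg.2 (by linarith))
          _ = _ := by
            rw [Real.mul_rpow (by linarith) (by positivity), ← Real.rpow_mul (by linarith),
              mul_one_div_cancel hm0, Real.rpow_one]
      have h3 : osc u (ball (0 : E d) (R + 2)) ≤ Z := by rw [hZ, zetaTwo]; linarith
      have h4 : Q * Z ≤ Q * M := mul_le_mul_of_nonneg_left hMZ (by linarith)
      refine max_le ?_ ((le_mul_of_one_le_left (by linarith) hQ1).trans h4)
      rw [zetaOne, Real.one_rpow, one_mul]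
      refine le_trans ?_ h4
      rw [hQ]
      linarith
  have hLL : C * CH (R + 2) ^ (1 / (1 - θ₀)) *
      max (zetaOne s m α f u R (max 1 R)) Z ^ e ≤
      C * Q ^ e * CH (R + 2) ^ (1 / (1 - θ₀)) * M ^ e := by
    have hmax0 : 0 ≤ max (zetaOne s m α f u R (max 1 R)) Z := le_trans (by linarith)
      (le_max_right _ _)
    calc _ ≤ C * CH (R + 2) ^ (1 / (1 - θ₀)) * (Q * M) ^ e := by gcongr
      _ = _ := by
        rw [Real.mul_rpow (by linarith) (by linarith)]
        ring
  exact ⟨hL0.trans_le hLL, fun x hx y hy => (hL x hx y hy).trans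
    (mul_le_mul_of_nonneg_right hLL (norm_nonneg _))⟩

end NonlocalHJ

end

/-! ### Assembly of the two growth regimes -/

theorem theorem2p1 (d : ℕ) (s m : ℝ) (hs : 1 / 2 < s) (hs' : s < 1) (hm : 1 ≤ m) :
    ∃ θbar : ℝ, 0 < θbar ∧ θbar ≤ 1 ∧ ∀ θ₀ : ℝ, 0 < θ₀ → θ₀ < θbar →
      ∀ lam Lam κ : ℝ, 0 < lam → lam ≤ Lam → 0 < κ →
        (∃ C : ℝ, 0 < C ∧
          ∀ (K : NonlocalHJ.E d → ℝ) (α : ℝ) (H : NonlocalHJ.E d → NonlocalHJ.E d → ℝ)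
            (CH : ℝ → ℝ) (f : NonlocalHJ.E d → ℝ),
            NonlocalHJ.Admissible d s m lam Lam κ K α H CH f →
          ∀ (R : ℝ) (u : NonlocalHJ.E d → ℝ), 0 < R → Continuous u →
            NonlocalHJ.MemL1Weighted d s u →
            NonlocalHJ.IsViscositySolution K α H f u (Metric.ball 0 (R + 2)) →
            (2 * s + 1 ≤ m →
              NonlocalHJ.IsLipschitzOnBall u R
                (C * CH (R + 2) ^ (1 / (1 - θ₀)) *
                  max (NonlocalHJ.zetaOne s m α f u R (max 1 R)) (NonlocalHJ.zetaTwo s f u R)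
                    ^ ((m - θ₀) / (1 - θ₀)))) ∧
            (m < 2 * s + 1 →
              NonlocalHJ.IsLipschitzOnBall u R
                (C * (max 1 (CH (R + 2))) ^ (1 / (2 * s + 1 - m - θ₀)) *
                  NonlocalHJ.zetaTwo s f u R
                    ^ ((2 * s - θ₀) / (2 * s + 1 - m - θ₀))))) ∧
        (2 * s + 1 ≤ m →
          ∀ (K : NonlocalHJ.E d → ℝ) (α : ℝ) (H : NonlocalHJ.E d → NonlocalHJ.E d → ℝ)
            (CH : ℝ → ℝ) (f : NonlocalHJ.E d → ℝ),
            NonlocalHJ.Admissible d s m lam Lam κ K α H CH f →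
          ∃ C : ℝ, 0 < C ∧
          ∀ (R : ℝ) (u : NonlocalHJ.E d → ℝ), 0 < R → Continuous u →
            NonlocalHJ.MemL1Weighted d s u →
            NonlocalHJ.IsViscositySolution K α H f u (Metric.ball 0 (R + 2)) →
              NonlocalHJ.IsLipschitzOnBall u R
                (C * CH (R + 2) ^ (1 / (1 - θ₀)) *
                  max (NonlocalHJ.zetaOne s m α f u R R) (NonlocalHJ.zetaTwo s f u R)
                    ^ ((m - θ₀) / (1 - θ₀)))) := by
  -- In dimension zero the space is a point, and only positivity of the constants has to be checked.
  rcases Nat.eq_zero_or_pos d with rfl | hd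
  · have hpos : ∀ (α : ℝ) (f u : NonlocalHJ.E 0 → ℝ) (R ρ : ℝ), 0 < R → Continuous f →
        Continuous u → 0 < max (NonlocalHJ.zetaOne s m α f u R ρ) (NonlocalHJ.zetaTwo s f u R) :=
      fun α f u R ρ hR hf hu => lt_max_of_lt_right
        (one_pos.trans_le (NonlocalHJ.one_le_zetaTwo hf hu hR))
    refine ⟨1, one_pos, le_rfl, fun θ₀ _ _ lam Lam κ _ _ _ => ⟨⟨1, one_pos, ?_⟩, ?_⟩⟩
    · intro K α H CH f hAd R u hR hu _ _
      have hCH := (hAd.hypH1 (R + 2) (by linarith)).1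
      have h1 := hpos α f u R (max 1 R) hR hAd.continuous_f hu
      have h2 := NonlocalHJ.one_le_zetaTwo (s := s) hAd.continuous_f hu hR
      have h3 : (1 : ℝ) ≤ max 1 (CH (R + 2)) := le_max_left _ _
      exact ⟨fun _ => NonlocalHJ.isLipschitzOnBall_of_subsingleton (by positivity),
        fun _ => NonlocalHJ.isLipschitzOnBall_of_subsingleton (by positivity)⟩
    · intro _ K α H CH f hAd
      refine ⟨1, one_pos, fun R u hR hu _ _ => ?_⟩
      have hCH := (hAd.hypH1 (R + 2) (by linarith)).1
      have h1 := hpos α f u R R hR hAd.continuous_f hu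
      exact NonlocalHJ.isLipschitzOnBall_of_subsingleton (by positivity)
  · rcases le_or_gt (2 * s + 1) m with hm' | hm'
    · refine ⟨1, one_pos, le_rfl, fun θ₀ hθ hθ₁ lam Lam κ hlam hLam hκ => ⟨?_, ?_⟩⟩
      · obtain ⟨C, hC, h⟩ := NonlocalHJ.exists_lipschitz_const_of_le hd hs hs' hm' hlam
          (hlam.le.trans hLam) hκ hθ hθ₁
        exact ⟨C, hC, fun K α H CH f hAd R u hR hu hL hsol =>
          ⟨fun _ => h K α H CH f hAd R u hR hu hL hsol, fun h' => absurd hm' (not_le.2 h')⟩⟩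
      · exact fun _ K α H CH f hAd => NonlocalHJ.exists_lipschitz_const_of_le_unscaled hd hs hs'
          hm' hlam (hlam.le.trans hLam) hκ hθ hθ₁ hAd
    -- The first bound keeps `σ = 2 * s - 1 - θ₀` positive, the second keeps the exponent `2 * s + 1
    -- - m - θ₀` of `L` positive.
    · refine ⟨min (2 * s - 1) (2 * s + 1 - m), lt_min (by linarith) (by linarith),
        (min_le_left _ _).trans (by linarith), fun θ₀ hθ hθ₁ lam Lam κ hlam hLam hκ =>
        ⟨?_, fun h' => absurd h' (not_le.2 hm')⟩⟩
      obtain ⟨C, hC, h⟩ := NonlocalHJ.exists_lipschitz_const_of_lt (κ := κ) hd hs hs' hm hlam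
        (hlam.le.trans hLam) hθ (hθ₁.trans_le (min_le_left _ _)) (hθ₁.trans_le (min_le_right _ _))
      exact ⟨C, hC, fun K α H CH f hAd R u hR hu hL hsol =>
        ⟨fun h' => absurd h' (not_le.2 hm'), fun _ => h K α H CH f hAd R u hR hu hL hsol⟩⟩
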